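/- Let $n\ge 2$. For $0\le s\le n$ let $\mathcal D_{n,s}$ be the arrangement of the hyperplanes in $\mathbb R^n$ with normal vectors $e_i\pm e_j$ $(1\le i<j\le n)$ and $e_i$ $(1\le i\le s)$, and let $\mathcal B_n=\mathcal D_{n,n}$. The chambers of an arrangement $\mathcal A$ are the closures of the connected components of the complement of the union of its hyperplanes; its cones are the intersections of nonempty sets of chambers; its rays are the cones spanning a $1$-dimensional subspace. Let $\Delta_{\mathcal A}$ be the complex whose simplices are the sets $\{r : r \text{ a ray of }\mathcal A,\ r\subseteq c\}$ for the cones $c$ of $\mathcal A$. If $\Delta_{\mathcal A}$ has dimension $d-1$ and $f_k$ simplices of dimension $k$ (where $f_{-1}$ counts the empty simplex), put $f(\mathcal A,t)=\sum_{i=0}^{d} f_{d-1-i}t^i$ and $h(\mathcal A,t)=f(\mathcal A,t-1)$. The $\gamma$-vector $(\gamma_0(\mathcal A),\dots,\gamma_{\lfloor d/2\rfloor}(\mathcal A))$ is the integer vector determined by $h(\mathcal A,t)=\sum_{i=0}^{\lfloor d/2\rfloor}\gamma_i(\mathcal A)\,t^i(1+t)^{d-2i}$. For a permutation $u=(u_1,\dots,u_N)\in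 S_N$ in one-line notation put $u_0=u_{N+1}=0$ and let $m(u)$ be the number of $j\in\{1,\dots,N\}$ with $u_{j-1}<u_j>u_{j+1}$. Then \[ h(\mathcal B_n,t)-h(\mathcal D_{n,n-1},t)=\frac12\sum_{u\in S_{n-1}}(4t)^{m(u)}(1+t)^{n-2m(u)} . \] Moreover, for every $0\le s\le n$ the arrangement $\mathcal D_{n,s}$ has a unique $\gamma$-vector, and for all $1\le i\le n$ and $0\le k\le\lfloor n/2\rfloor$, \[ \gamma_k(\mathcal D_{n,i})-\gamma_k(\mathcal D_{n,i-1})=\frac12\cdot 4^k\cdot\#\{u\in S_{n-1} : m(u)=k\}. \] -/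

import Mathlib

open Polynomial

namespace SimplicialArrangement

noncomputable section

/-! Real central arrangements, their chambers, cones and rays. -/

/-- The hyperplane `H_α = {x ∈ ℝⁿ | α₁ x₁ + ⋯ + αₙ xₙ = 0}` with normal vector `α`. -/
def hyperplane {n : ℕ} (α : Fin n → ℝ) : Submodule ℝ (Fin n → ℝ) where
  carrier := {x | α ⬝ᵥ x = 0}
  add_mem' := by
    intro x y hx hy
    simp only [Set.mem_ofPred_eq] at hx hy ⊢
    rw [dotProduct_add, hx, hy, add_zero]
  zero_mem' := by simp
  smul_mem' := by
    intro c x hx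
    simp only [Set.mem_ofPred_eq] at hx ⊢
    rw [dotProduct_smul, hx, smul_zero]

/-- The arrangement consisting of the hyperplanes with normal vectors in `N`. -/
def arrangement {n : ℕ} (N : Set (Fin n → ℝ)) : Set (Submodule ℝ (Fin n → ℝ)) :=
  hyperplane '' N

/-- The complement `ℝⁿ ∖ ⋃_{H ∈ A} H` of an arrangement. -/
def complement {n : ℕ} (A : Set (Submodule ℝ (Fin n → ℝ))) : Set (Fin n → ℝ) :=
  {x | ∀ H ∈ A, x ∉ H}

/-- The chambers of `A`: closures of the connected components of the complement. -/
def chambers {n : ℕ} (A : Set (Submodule ℝ (Fin n → ℝ))) : Set (Set (Fin n → ℝ)) :=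
  {C | ∃ x ∈ complement A, C = closure (connectedComponentIn (complement A) x)}

/-- The cones of `A`: intersections of nonempty sets of chambers. -/
def cones {n : ℕ} (A : Set (Submodule ℝ (Fin n → ℝ))) : Set (Set (Fin n → ℝ)) :=
  {c | ∃ S ⊆ chambers A, S.Nonempty ∧ c = ⋂₀ S}

/-- The rays of `A`: the cones that span a one-dimensional subspace. -/
def rays {n : ℕ} (A : Set (Submodule ℝ (Fin n → ℝ))) : Set (Set (Fin n → ℝ)) :=
  {r | r ∈ cones A ∧ Module.finrank ℝ (Submodule.span ℝ r) = 1}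

/-- The complex `Δ_A` on the vertex set `rays A`: its simplices are the sets of the form
`{r | r is a ray contained in c}`, for `c` a cone of `A` (the cone `{0}` gives the empty simplex). -/
def complex {n : ℕ} (A : Set (Submodule ℝ (Fin n → ℝ))) : Set (Set (Set (Fin n → ℝ))) :=
  {σ | ∃ c ∈ cones A, σ = {r | r ∈ rays A ∧ r ⊆ c}}

/-! The `f`-polynomial, `h`-polynomial and `γ`-vector of a simplicial complex, given as its family
of simplices (the empty simplex included). -/

/-- The number of simplices with exactly `j` vertices, that is `f_{j-1}`. -/
def faceCount {V : Type*} (Δ : Set (Set V)) (j : ℕ) : ℕ :=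
  {σ | σ ∈ Δ ∧ σ.encard = j}.ncard

/-- The number `d` for which the complex has dimension `d - 1`: the largest number of vertices
of a simplex. -/
def rankOf {V : Type*} (Δ : Set (Set V)) : ℕ :=
  sSup {j : ℕ | ∃ σ ∈ Δ, σ.encard = j}

/-- `f(t) = ∑_{i=0}^{d} f_{d-1-i} t^i`. -/
def fPoly {V : Type*} (Δ : Set (Set V)) : ℤ[X] :=
  ∑ i ∈ Finset.range (rankOf Δ + 1), C (faceCount Δ (rankOf Δ - i) : ℤ) * X ^ i

/-- `h(t) = f(t - 1)`. -/
def hPoly {V : Type*} (Δ : Set (Set V)) : ℤ[X] :=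
  (fPoly Δ).comp (X - 1)

/-- `γ = (γ_0, …, γ_{⌊d/2⌋})` is the `γ`-vector of the complex:
`h(t) = ∑_{i=0}^{⌊d/2⌋} γ_i t^i (1+t)^{d-2i}` (with `γ_i = 0` for the indices `i > ⌊d/2⌋`). -/
def IsGammaVector {V : Type*} (Δ : Set (Set V)) (γ : ℕ → ℤ) : Prop :=
  (∀ i, rankOf Δ / 2 < i → γ i = 0) ∧
  hPoly Δ = ∑ i ∈ Finset.range (rankOf Δ / 2 + 1),
    C (γ i) * X ^ i * (1 + X) ^ (rankOf Δ - 2 * i)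

/-! The arrangements of type `B` and the intermediate arrangements. -/

/-- The standard basis vector `e_i`. -/
def e {n : ℕ} (i : Fin n) : Fin n → ℝ := Pi.single i 1

/-- `B_n`, with normals `e_i ± e_j` for `i < j` and `e_i` for all `i`. -/
def typeB (n : ℕ) : Set (Submodule ℝ (Fin n → ℝ)) :=
  arrangement ({v | ∃ i j : Fin n, i < j ∧ (v = e i + e j ∨ v = e i - e j)} ∪
    {v | ∃ i : Fin n, v = e i})

/-- `D_{n,s}`, with normals `e_i ± e_j` for `i < j`, and `e_i` for the first `s` indices `i`
(the elements of `Fin n` are numbered from `0`). -/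
def intermediate (n s : ℕ) : Set (Submodule ℝ (Fin n → ℝ)) :=
  arrangement ({v | ∃ i j : Fin n, i < j ∧ (v = e i + e j ∨ v = e i - e j)} ∪
    {v | ∃ i : Fin n, (i : ℕ) < s ∧ v = e i})

end

/-! Maxima of permutations. -/

/-- The one-line notation `u_1, …, u_N` (with values in `{1, …, N}`) of a permutation of `N`
elements, extended by `u_0 = u_{N+1} = 0`. -/
def oneLine {N : ℕ} (u : Equiv.Perm (Fin N)) (j : ℕ) : ℕ :=
  if h : 1 ≤ j ∧ j ≤ N then (u ⟨j - 1, by omega⟩ : ℕ) + 1 else 0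

/-- `m(u)`: the number of `j ∈ {1, …, N}` with `u_{j-1} < u_j > u_{j+1}`. -/
def numMaxima {N : ℕ} (u : Equiv.Perm (Fin N)) : ℕ :=
  ((Finset.Icc 1 N).filter fun j =>
    oneLine u (j - 1) < oneLine u j ∧ oneLine u (j + 1) < oneLine u j).card

end SimplicialArrangement

open SimplicialArrangement

/-!
The faces of `D_{n,s}` are described combinatorially, counted by dimension, and the resulting
polynomials are compared through the recursions that they satisfy.

*Faces.* For any finite central arrangement the cones are the sets `face N x` of points on which no
normal vector takes a sign that it does not take at `x` (`mem_cones_iff`). For `D_{n,s}` with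
`2 ≤ n` the pairs of hyperplanes `x_i = ± x_j` see the order of the absolute values of the
coordinates and the sign of every coordinate, except that of a strictly smallest one, which is seen
only if its index is among the first `s` (`faceLE_iff`). Hence a face is represented by exactly one
integer vector whose nonzero absolute values are `1, …, k` and whose unseen smallest coordinate, if
there is one, is `1` (`exists_isNormalForm`, `IsNormalForm.eq_of_faceLE`). Such a face has exactly
`k` rays, which are written down explicitly and determine the face (`encard_raysOf`,
`raysOf_injOn`). So the number of simplices with `k` vertices is the number of normal forms of
level `k` (`faceCount_intermediate`).

*Counting.* For `s = n` the normal forms are all packed vectors. Passing from `s` to `s + 1` adds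
the packed vectors whose strictly smallest coordinate sits in the new position and equals `0` or
`-1`; their number does not depend on `s` (`ncard_isNormalForm_succ`). Both kinds of vectors are
counted by the numbers `signedSurjCount`, and in terms of the polynomials `surjPoly` one obtains
`h(B_n) = surjPoly 1 n` and `h(D_{n,s+1}) - h(D_{n,s}) = X * surjPoly 0 (n - 1)`.

*γ-expansions.* Both `surjPoly 1 n` and `X * surjPoly 0 n` satisfy a recursion given by the
differential operator `eulerOp`, which maps `X^i (1+X)^(d-2i)` to a nonnegative combination of two
such polynomials of degree `d + 1` (`eulerOp_gammaBasis`). This gives all γ-vectors. Inserting the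
largest letter into the one-line notation of a permutation either keeps or increases by one the
number of maxima, and the number of places of each kind matches the two coefficients in
`eulerOp_gammaBasis`, so that `2 X surjPoly 0 N = ∑_u (4X)^{m(u)} (1+X)^{N+1-2m(u)}`
(`two_mul_X_mul_surjPoly_zero`).
-/

namespace SimplicialArrangement

open Filter Topology

/-! ### Faces of a finite central arrangement -/

/-- `a` has the same sign as `b`, or vanishes. -/
def SignLE {R : Type*} [Zero R] [LinearOrder R] (a b : R) : Prop :=
  (b = 0 → a = 0) ∧ (0 < b → 0 ≤ a) ∧ (b < 0 → a ≤ 0)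

/-- The closed face through `x` of the arrangement with normal vectors `N`: the points on which no
normal vector takes a sign that it does not take at `x`. -/
def face {n : ℕ} (N : Set (Fin n → ℝ)) (x : Fin n → ℝ) : Set (Fin n → ℝ) :=
  {y | ∀ α ∈ N, SignLE (α ⬝ᵥ y) (α ⬝ᵥ x)}

section SignLE

lemma SignLE.refl {R : Type*} [Zero R] [LinearOrder R] (a : R) : SignLE a a :=
  ⟨id, le_of_lt, le_of_lt⟩

lemma SignLE.trans {R : Type*} [Zero R] [LinearOrder R] {a b c : R} (h : SignLE a b)
    (h' : SignLE b c) : SignLE a c := by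
  obtain ⟨h1, h2, h3⟩ := h
  obtain ⟨h4, h5, h6⟩ := h'
  refine ⟨fun hc => h1 (h4 hc), fun hc => ?_, fun hc => ?_⟩
  · rcases (h5 hc).lt_or_eq with hb | hb
    · exact h2 hb
    · exact (h1 hb.symm).ge
  · rcases (h6 hc).lt_or_eq with hb | hb
    · exact h3 hb
    · exact (h1 hb).le

lemma SignLE.zero {R : Type*} [Zero R] [LinearOrder R] (b : R) : SignLE 0 b :=
  ⟨fun _ => rfl, fun _ => le_rfl, fun _ => le_rfl⟩

variable {R : Type*} [CommRing R] [LinearOrder R] [IsStrictOrderedRing R]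

lemma SignLE.add {a a' b : R} (h : SignLE a b) (h' : SignLE a' b) : SignLE (a + a') b :=
  ⟨fun hb => by rw [h.1 hb, h'.1 hb, add_zero], fun hb => add_nonneg (h.2.1 hb) (h'.2.1 hb),
    fun hb => add_nonpos (h.2.2 hb) (h'.2.2 hb)⟩

lemma signLE_iff_mul_nonneg {a b : R} (hb : b ≠ 0) : SignLE a b ↔ 0 ≤ a * b := by
  rcases hb.lt_or_gt with h | h
  · simp only [SignLE, hb, h, h.not_gt, false_imp_iff, true_imp_iff, true_and]
    exact ⟨fun ha => mul_nonneg_of_nonpos_of_nonpos ha h.le, fun h' => not_lt.1 fun ha =>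
      (mul_neg_of_pos_of_neg ha h).not_ge h'⟩
  · simp [SignLE, hb, h, h.not_gt, mul_nonneg_iff_of_pos_right]

end SignLE

variable {n : ℕ} {N : Set (Fin n → ℝ)}

lemma mem_complement_arrangement {x : Fin n → ℝ} :
    x ∈ complement (arrangement N) ↔ ∀ α ∈ N, α ⬝ᵥ x ≠ 0 := by
  simp [complement, arrangement, hyperplane]

lemma mem_face_self (x : Fin n → ℝ) : x ∈ face N x := fun _ _ => SignLE.refl _

lemma face_subset_face_iff {x y : Fin n → ℝ} : face N x ⊆ face N y ↔ x ∈ face N y :=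
  ⟨fun h => h (mem_face_self x), fun h _ hz α hα => (hz α hα).trans (h α hα)⟩

lemma connectedComponentIn_complement {x : Fin n → ℝ} (hx : x ∈ complement (arrangement N)) :
    connectedComponentIn (complement (arrangement N)) x =
      {y | ∀ α ∈ N, 0 < (α ⬝ᵥ y) * (α ⬝ᵥ x)} := by
  have hx' := mem_complement_arrangement.1 hx
  apply Set.Subset.antisymm
  · intro y hy α hα
    by_contra hneg
    have hpre : IsPreconnected (connectedComponentIn (complement (arrangement N)) x) :=
      isPreconnected_connectedComponentIn
    have hcont : Continuous fun z : Fin n → ℝ => (α ⬝ᵥ z) * (α ⬝ᵥ x) := by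
      unfold dotProduct; fun_prop
    obtain ⟨z, hz, hz0⟩ := hpre.intermediate_value hy (mem_connectedComponentIn hx)
      hcont.continuousOn ⟨not_lt.1 hneg, mul_self_nonneg (α ⬝ᵥ x)⟩
    have := mem_complement_arrangement.1 (connectedComponentIn_subset _ _ hz) α hα
    exact mul_ne_zero this (hx' α hα) hz0
  · apply IsPreconnected.subset_connectedComponentIn
    · apply Convex.isPreconnected
      intro y hy z hz a b ha hb hab α hα
      have h1 := hy α hα
      have h2 := hz α hα
      rw [dotProduct_add, dotProduct_smul, dotProduct_smul, smul_eq_mul, smul_eq_mul, add_mul,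
        mul_assoc, mul_assoc]
      rcases ha.lt_or_eq with ha | rfl
      · have := mul_pos ha h1
        have := mul_nonneg hb h2.le
        linarith
      · rw [zero_add] at hab
        subst hab
        linarith
    · intro α hα
      exact mul_self_pos.2 (hx' α hα)
    · intro y hy
      rw [mem_complement_arrangement]
      intro α hα h0
      have := hy α hα
      rw [h0, zero_mul] at this
      exact this.false

lemma closure_connectedComponentIn_complement {x : Fin n → ℝ}
    (hx : x ∈ complement (arrangement N)) :
    closure (connectedComponentIn (complement (arrangement N)) x) = face N x := by
  rw [connectedComponentIn_complement hx]
  have hx' := mem_complement_arrangement.1 hx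
  have hface : face N x = {y | ∀ α ∈ N, 0 ≤ (α ⬝ᵥ y) * (α ⬝ᵥ x)} := by
    ext y
    exact forall₂_congr fun α hα => signLE_iff_mul_nonneg (hx' α hα)
  rw [hface]
  apply Set.Subset.antisymm
  · apply closure_minimal
    · exact fun y hy α hα => (hy α hα).le
    · simp only [Set.ofPred_forall]
      refine isClosed_iInter fun α => isClosed_iInter fun _ => isClosed_le continuous_const ?_
      unfold dotProduct
      fun_prop
  · intro y hy
    have hlim : Tendsto (fun ε : ℝ => y + ε • x) (𝓝[>] 0) (𝓝 y) := by
      have : Continuous fun ε : ℝ => y + ε • x := by fun_prop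
      have h := this.tendsto 0
      simp only [zero_smul, add_zero] at h
      exact h.mono_left nhdsWithin_le_nhds
    refine mem_closure_of_tendsto hlim ?_
    filter_upwards [self_mem_nhdsWithin] with ε hε α hα
    rw [dotProduct_add, dotProduct_smul, smul_eq_mul, add_mul, mul_assoc]
    have := hy α hα
    have := mul_pos (show (0 : ℝ) < ε from hε) (mul_self_pos.2 (hx' α hα))
    linarith

lemma mem_chambers_iff {c : Set (Fin n → ℝ)} :
    c ∈ chambers (arrangement N) ↔ ∃ x, (∀ α ∈ N, α ⬝ᵥ x ≠ 0) ∧ c = face N x := by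
  constructor
  · rintro ⟨x, hx, rfl⟩
    exact ⟨x, mem_complement_arrangement.1 hx, closure_connectedComponentIn_complement hx⟩
  · rintro ⟨x, hx, rfl⟩
    have hx := mem_complement_arrangement.2 hx
    exact ⟨x, hx, (closure_connectedComponentIn_complement hx).symm⟩

/-- A small displacement in a generic direction leads from `x` into a chamber with `x` on its
boundary. -/
lemma eventually_add_smul_generic (hN : N.Finite) (x : Fin n → ℝ) {z : Fin n → ℝ}
    (hz : ∀ α ∈ N, α ⬝ᵥ z ≠ 0) :
    ∀ᶠ ε in 𝓝[>] (0 : ℝ), ∀ α ∈ N, α ⬝ᵥ (x + ε • z) ≠ 0 ∧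
      SignLE (α ⬝ᵥ x) (α ⬝ᵥ (x + ε • z)) ∧
        (α ⬝ᵥ x = 0 → α ⬝ᵥ (x + ε • z) = ε * (α ⬝ᵥ z)) := by
  rw [eventually_all_finite hN]
  intro α hα
  have hcont : Tendsto (fun ε : ℝ => α ⬝ᵥ (x + ε • z)) (𝓝[>] 0) (𝓝 (α ⬝ᵥ x)) := by
    have : Continuous fun ε : ℝ => α ⬝ᵥ (x + ε • z) := by
      unfold dotProduct; fun_prop
    have h := this.tendsto 0
    simp only [zero_smul, add_zero] at h
    exact h.mono_left nhdsWithin_le_nhds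
  rcases lt_trichotomy (α ⬝ᵥ x) 0 with h | h | h
  · filter_upwards [hcont.eventually_lt_const h] with ε hε
    exact ⟨hε.ne, ⟨fun h => absurd h hε.ne, fun h => absurd h hε.not_gt, fun _ => h.le⟩,
      fun h' => absurd h' h.ne⟩
  · filter_upwards [self_mem_nhdsWithin] with ε hε
    have heq : α ⬝ᵥ (x + ε • z) = ε * (α ⬝ᵥ z) := by
      rw [dotProduct_add, dotProduct_smul, h, zero_add, smul_eq_mul]
    refine ⟨?_, by rw [h]; exact SignLE.zero _, fun _ => heq⟩
    rw [heq]
    exact mul_ne_zero (show (0 : ℝ) < ε from hε).ne' (hz α hα)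
  · filter_upwards [hcont.eventually_const_lt h] with ε hε
    exact ⟨hε.ne', ⟨fun h => absurd h hε.ne', fun _ => h.le, fun h => absurd h hε.not_gt⟩,
      fun h' => absurd h' h.ne'⟩

/-- Every face is the intersection of two chambers, which lie on opposite sides of it. -/
lemma face_mem_cones (hN : N.Finite) {z : Fin n → ℝ} (hz : ∀ α ∈ N, α ⬝ᵥ z ≠ 0)
    (x : Fin n → ℝ) : face N x ∈ cones (arrangement N) := by
  have hz' : ∀ α ∈ N, α ⬝ᵥ (-z) ≠ 0 := fun α hα => by
    rw [dotProduct_neg]; exact neg_ne_zero.2 (hz α hα)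
  obtain ⟨ε, ⟨h1, h2⟩, hε⟩ := ((eventually_add_smul_generic hN x hz).and
    (eventually_add_smul_generic hN x hz') |>.and self_mem_nhdsWithin).exists
  refine ⟨{face N (x + ε • z), face N (x + ε • (-z))}, ?_, Set.insert_nonempty _ _, ?_⟩
  · rintro c (rfl | rfl)
    · exact mem_chambers_iff.2 ⟨_, fun α hα => (h1 α hα).1, rfl⟩
    · exact mem_chambers_iff.2 ⟨_, fun α hα => (h2 α hα).1, rfl⟩
  · rw [Set.sInter_insert, Set.sInter_singleton]
    apply Set.Subset.antisymm
    · exact fun y hy => ⟨fun α hα => (hy α hα).trans (h1 α hα).2.1,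
        fun α hα => (hy α hα).trans (h2 α hα).2.1⟩
    · rintro y ⟨hy1, hy2⟩ α hα
      have a1 := hy1 α hα
      have a2 := hy2 α hα
      obtain ⟨n1, s1, t1⟩ := h1 α hα
      obtain ⟨n2, s2, t2⟩ := h2 α hα
      rw [signLE_iff_mul_nonneg n1] at a1 s1
      rw [signLE_iff_mul_nonneg n2] at a2 s2
      by_cases h0 : α ⬝ᵥ x = 0
      · rw [t1 h0] at a1
        rw [t2 h0, dotProduct_neg] at a2
        have hne : ε * (α ⬝ᵥ z) ≠ 0 :=
          mul_ne_zero (show (0 : ℝ) < ε from hε).ne' (hz α hα)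
        have : (α ⬝ᵥ y) * (ε * (α ⬝ᵥ z)) = 0 := by nlinarith
        rw [(mul_eq_zero.1 this).resolve_right hne]
        exact SignLE.zero _
      · rw [signLE_iff_mul_nonneg h0]
        -- the sign at `x + ε z` agrees with the sign at `x`
        rcases lt_or_gt_of_ne h0 with h | h <;> rcases lt_or_gt_of_ne n1 with h' | h' <;> nlinarith

/-- The cones are the faces: a point of a cone at which as many normal vectors as possible are
nonzero exhibits the cone as a face. -/
lemma exists_eq_face_of_mem_cones (hN : N.Finite) {c : Set (Fin n → ℝ)}
    (hc : c ∈ cones (arrangement N)) : ∃ x, c = face N x := by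
  obtain ⟨S, hS, ⟨C₀, hC₀⟩, rfl⟩ := hc
  obtain ⟨x₀, hx₀, hCx₀⟩ := mem_chambers_iff.1 (hS hC₀)
  have hsum : ∀ (T : Finset (Fin n → ℝ)) (w : (Fin n → ℝ) → Fin n → ℝ),
      (∀ α ∈ T, w α ∈ ⋂₀ S) → ∑ α ∈ T, w α ∈ ⋂₀ S := by
    intro T w hw C hC
    obtain ⟨x, -, rfl⟩ := mem_chambers_iff.1 (hS hC)
    intro β hβ
    rw [dotProduct_sum]
    refine Finset.sum_induction _ (fun a => SignLE a (β ⬝ᵥ x)) (fun a b => SignLE.add)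
      (SignLE.zero _) fun α hα => hw α hα _ hC β hβ
  have hex : ∀ α : Fin n → ℝ, ∃ w ∈ ⋂₀ S, (∃ y ∈ ⋂₀ S, α ⬝ᵥ y ≠ 0) → α ⬝ᵥ w ≠ 0 := by
    intro α
    by_cases h : ∃ y ∈ ⋂₀ S, α ⬝ᵥ y ≠ 0
    · obtain ⟨y, hy, hy'⟩ := h
      exact ⟨y, hy, fun _ => hy'⟩
    · exact ⟨0, by simpa using hsum ∅ (fun _ => 0) (by simp), fun h' => absurd h' h⟩
  choose w hw hw' using hex
  have hx := hsum hN.toFinset w fun α _ => hw α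
  refine ⟨∑ α ∈ hN.toFinset, w α, Set.Subset.antisymm ?_ ?_⟩
  · intro y hy α hα
    have hpos : ∀ v ∈ ⋂₀ S, 0 ≤ (α ⬝ᵥ v) * (α ⬝ᵥ x₀) := fun v hv =>
      (signLE_iff_mul_nonneg (hx₀ α hα)).1 ((hCx₀ ▸ hv C₀ hC₀ : v ∈ face N x₀) α hα)
    by_cases h0 : α ⬝ᵥ y = 0
    · rw [h0]; exact SignLE.zero _
    have h1 : 0 < (α ⬝ᵥ w α) * (α ⬝ᵥ x₀) := lt_of_le_of_ne (hpos _ (hw α))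
      (mul_ne_zero (hw' α ⟨y, hy, h0⟩) (hx₀ α hα)).symm
    have h2 : (α ⬝ᵥ w α) * (α ⬝ᵥ x₀) ≤ (α ⬝ᵥ ∑ β ∈ hN.toFinset, w β) * (α ⬝ᵥ x₀) := by
      rw [dotProduct_sum, Finset.sum_mul]
      exact Finset.single_le_sum (f := fun β => (α ⬝ᵥ w β) * (α ⬝ᵥ x₀))
        (fun β _ => hpos _ (hw β)) (hN.mem_toFinset.2 hα)
    have h3 := h1.trans_le h2
    have h4 := hpos y hy
    have h5 : α ⬝ᵥ ∑ β ∈ hN.toFinset, w β ≠ 0 := fun h => by simp [h] at h3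
    rw [signLE_iff_mul_nonneg h5]
    rcases lt_or_gt_of_ne (hx₀ α hα) with h | h
    · exact mul_nonneg_of_nonpos_of_nonpos (by nlinarith) (by nlinarith)
    · exact mul_nonneg (by nlinarith) (by nlinarith)
  · intro y hy C hC
    have := hx C hC
    obtain ⟨x, -, rfl⟩ := mem_chambers_iff.1 (hS hC)
    exact face_subset_face_iff.2 this hy

lemma mem_cones_iff (hN : N.Finite) {z : Fin n → ℝ} (hz : ∀ α ∈ N, α ⬝ᵥ z ≠ 0)
    {c : Set (Fin n → ℝ)} : c ∈ cones (arrangement N) ↔ ∃ x, c = face N x :=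
  ⟨exists_eq_face_of_mem_cones hN, by rintro ⟨x, rfl⟩; exact face_mem_cones hN hz x⟩

/-! ### The face order of the intermediate arrangements -/

/-- The normal vectors of `D_{n,s}`. -/
def normals (n s : ℕ) : Set (Fin n → ℝ) :=
  {v | ∃ i j : Fin n, i < j ∧ (v = e i + e j ∨ v = e i - e j)} ∪
    {v | ∃ i : Fin n, (i : ℕ) < s ∧ v = e i}

lemma intermediate_eq (n s : ℕ) : intermediate n s = arrangement (normals n s) := rfl

lemma typeB_eq_intermediate (n : ℕ) : typeB n = intermediate n n := by
  simp [typeB, intermediate]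

lemma finite_normals (n s : ℕ) : (normals n s).Finite := by
  have : normals n s ⊆ (Set.range fun p : Fin n × Fin n => (e p.1 + e p.2 : Fin n → ℝ)) ∪
      (Set.range fun p : Fin n × Fin n => (e p.1 - e p.2 : Fin n → ℝ)) ∪ Set.range e := by
    rintro v (⟨i, j, -, rfl | rfl⟩ | ⟨i, -, rfl⟩)
    · exact Or.inl (Or.inl ⟨(i, j), rfl⟩)
    · exact Or.inl (Or.inr ⟨(i, j), rfl⟩)
    · exact Or.inr ⟨i, rfl⟩
  exact (((Set.finite_range _).union (Set.finite_range _)).union (Set.finite_range _)).subset this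

section Order

variable {R : Type*} [CommRing R] [LinearOrder R] [IsStrictOrderedRing R] {n s : ℕ}

/-- `y` lies in the closed face of `D_{n,s}` through `x`; this makes sense over any ordered ring. -/
def FaceLE (s : ℕ) (y x : Fin n → R) : Prop :=
  (∀ i j, i ≠ j → SignLE (y i + y j) (x i + x j) ∧ SignLE (y i - y j) (x i - x j)) ∧
    ∀ i : Fin n, (i : ℕ) < s → SignLE (y i) (x i)

/-- `x i` is the strictly smallest coordinate in absolute value, and the `i`-th coordinate
hyperplane does not belong to `D_{n,s}`. The arrangement then does not see the sign of `x i`. -/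
def LoneMin (s : ℕ) (x : Fin n → R) (i : Fin n) : Prop :=
  s ≤ i ∧ ∀ j, j ≠ i → |x i| < |x j|

lemma FaceLE.trans {R : Type*} [CommRing R] [LinearOrder R] {x y z : Fin n → R}
    (h : FaceLE s x y) (h' : FaceLE s y z) : FaceLE s x z :=
  ⟨fun i j hij => ⟨(h.1 i j hij).1.trans (h'.1 i j hij).1, (h.1 i j hij).2.trans (h'.1 i j hij).2⟩,
    fun i hi => (h.2 i hi).trans (h'.2 i hi)⟩

lemma FaceLE.abs_le_and_signLE {x y : Fin n → R} (h : FaceLE s y x) {i j : Fin n} (hij : i ≠ j)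
    (hle : |x i| ≤ |x j|) : |y i| ≤ |y j| ∧ SignLE (y j) (x j) := by
  obtain ⟨⟨a1, a2, a3⟩, b1, b2, b3⟩ := h.1 i j hij
  rcases lt_trichotomy (x j) 0 with hj | hj | hj
  · rw [abs_of_neg hj, abs_le] at hle
    have h1 : y i + y j ≤ 0 := by
      rcases lt_or_eq_of_le (show x i + x j ≤ 0 by linarith) with h | h
      · exact a3 h
      · exact (a1 h).le
    have h2 : 0 ≤ y i - y j := by
      rcases lt_or_eq_of_le (show 0 ≤ x i - x j by linarith) with h | h
      · exact b2 h
      · exact (b1 h.symm).ge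
    have h3 : y j ≤ 0 := by linarith
    refine ⟨?_, fun h => absurd h hj.ne, fun h => absurd h hj.not_gt, fun _ => h3⟩
    rw [abs_of_nonpos h3, abs_le]
    constructor <;> linarith
  · rw [hj, abs_zero] at hle
    have hi : x i = 0 := abs_nonpos_iff.1 hle
    have h1 := a1 (by rw [hi, hj, add_zero])
    have h2 := b1 (by rw [hi, hj, sub_zero])
    have h3 : y j = 0 := by linarith
    have h4 : y i = 0 := by linarith
    rw [h3, h4]
    exact ⟨le_rfl, SignLE.zero _⟩
  · rw [abs_of_pos hj, abs_le] at hle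
    have h1 : 0 ≤ y i + y j := by
      rcases lt_or_eq_of_le (show 0 ≤ x i + x j by linarith) with h | h
      · exact a2 h
      · exact (a1 h.symm).ge
    have h2 : y i - y j ≤ 0 := by
      rcases lt_or_eq_of_le (show x i - x j ≤ 0 by linarith) with h | h
      · exact b3 h
      · exact (b1 h).le
    have h3 : 0 ≤ y j := by linarith
    refine ⟨?_, fun h => absurd h hj.ne', fun _ => h3, fun h => absurd h hj.not_gt⟩
    rw [abs_of_nonneg h3, abs_le]
    constructor <;> linarith

lemma signLE_add_and_sub {a b c d : R} (hlt : |c| < |d|) (hab : |a| ≤ |b|) (hb : SignLE b d) :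
    SignLE (a + b) (c + d) ∧ SignLE (a - b) (c - d) := by
  obtain ⟨h1, h2, h3⟩ := hb
  rcases lt_trichotomy d 0 with hd | hd | hd
  · have hb := h3 hd
    rw [abs_of_neg hd, abs_lt] at hlt
    rw [abs_of_nonpos hb, abs_le] at hab
    refine ⟨⟨?_, ?_, ?_⟩, ⟨?_, ?_, ?_⟩⟩ <;> intro h <;> linarith
  · rw [hd, abs_zero] at hlt
    exact absurd hlt (abs_nonneg c).not_gt
  · have hb := h2 hd
    rw [abs_of_pos hd, abs_lt] at hlt
    rw [abs_of_nonneg hb, abs_le] at hab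
    refine ⟨⟨?_, ?_, ?_⟩, ⟨?_, ?_, ?_⟩⟩ <;> intro h <;> linarith

lemma signLE_add_and_sub_of_abs_eq {a b c d : R} (heq : |c| = |d|) (hab : |a| = |b|)
    (ha : SignLE a c) (hb : SignLE b d) :
    SignLE (a + b) (c + d) ∧ SignLE (a - b) (c - d) := by
  obtain ⟨h1, h2, h3⟩ := hb
  obtain ⟨k1, k2, k3⟩ := ha
  rcases lt_trichotomy d 0 with hd | hd | hd
  · have hb := h3 hd
    rcases abs_eq_abs.1 heq with rfl | rfl
    · have ha := k3 hd
      rw [abs_of_nonpos ha, abs_of_nonpos hb] at hab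
      refine ⟨⟨?_, ?_, ?_⟩, ⟨?_, ?_, ?_⟩⟩ <;> intro h <;> linarith
    · have ha := k2 (by linarith)
      rw [abs_of_nonneg ha, abs_of_nonpos hb] at hab
      refine ⟨⟨?_, ?_, ?_⟩, ⟨?_, ?_, ?_⟩⟩ <;> intro h <;> linarith
  · have hc : c = 0 := abs_eq_zero.1 (by rw [heq, hd, abs_zero])
    rw [h1 hd, k1 hc, add_zero, sub_zero]
    exact ⟨SignLE.zero _, SignLE.zero _⟩
  · have hb := h2 hd
    rcases abs_eq_abs.1 heq with rfl | rfl
    · have ha := k2 hd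
      rw [abs_of_nonneg ha, abs_of_nonneg hb] at hab
      refine ⟨⟨?_, ?_, ?_⟩, ⟨?_, ?_, ?_⟩⟩ <;> intro h <;> linarith
    · have ha := k3 (by linarith)
      rw [abs_of_nonpos ha, abs_of_nonneg hb] at hab
      refine ⟨⟨?_, ?_, ?_⟩, ⟨?_, ?_, ?_⟩⟩ <;> intro h <;> linarith

lemma SignLE.neg {a b : R} (h : SignLE a b) : SignLE (-a) (-b) :=
  ⟨fun hb => by rw [h.1 (neg_eq_zero.1 hb), neg_zero],
    fun hb => neg_nonneg.2 (h.2.2 (neg_pos.1 hb)),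
    fun hb => neg_nonpos.2 (h.2.1 (neg_lt_zero.1 hb))⟩

/-- The face order of `D_{n,s}` in terms of absolute values and signs of coordinates: the pairs of
hyperplanes `x_i = ± x_j` see the order of the absolute values, and all signs except that of a
strictly smallest coordinate. -/
lemma faceLE_iff {x y : Fin n → R} :
    FaceLE s y x ↔ (∀ i j, i ≠ j → |x i| ≤ |x j| → |y i| ≤ |y j|) ∧
      ∀ j, ¬ LoneMin s x j → SignLE (y j) (x j) := by
  constructor
  · intro h
    refine ⟨fun i j hij hle => (h.abs_le_and_signLE hij hle).1, fun j hj => ?_⟩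
    by_cases hjs : (j : ℕ) < s
    · exact h.2 j hjs
    · unfold LoneMin at hj
      push Not at hj
      obtain ⟨i, hij, hle⟩ := hj (not_lt.1 hjs)
      exact (h.abs_le_and_signLE hij hle).2
  · rintro ⟨h1, h2⟩
    refine ⟨fun i j hij => ?_, fun i hi => h2 i fun h => absurd h.1 (not_le.2 hi)⟩
    rcases lt_trichotomy |x i| |x j| with h | h | h
    · exact signLE_add_and_sub h (h1 i j hij h.le) (h2 j fun hl => (hl.2 i hij).not_gt h)
    · exact signLE_add_and_sub_of_abs_eq h
        (le_antisymm (h1 i j hij h.le) (h1 j i hij.symm h.ge))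
        (h2 i fun hl => (hl.2 j hij.symm).ne h) (h2 j fun hl => (hl.2 i hij).ne' h)
    · obtain ⟨h3, h4⟩ := signLE_add_and_sub h (h1 j i hij.symm h.le)
        (h2 i fun hl => (hl.2 j hij.symm).not_gt h)
      rw [add_comm (y i), add_comm (x i), ← neg_sub (y j), ← neg_sub (x j)]
      exact ⟨h3, h4.neg⟩

lemma loneMin_congr {R R' : Type*} [CommRing R] [LinearOrder R] [CommRing R'] [LinearOrder R']
    {x : Fin n → R} {y : Fin n → R'}
    (h : ∀ i j, i ≠ j → (|x i| < |x j| ↔ |y i| < |y j|)) (i : Fin n) :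
    LoneMin s x i ↔ LoneMin s y i :=
  and_congr_right fun _ => forall₂_congr fun j hj => h i j hj.symm

end Order

variable {n s : ℕ}

lemma mem_face_normals {x y : Fin n → ℝ} : y ∈ face (normals n s) x ↔ FaceLE s y x := by
  have hadd : ∀ (i j : Fin n) (v : Fin n → ℝ), (e i + e j) ⬝ᵥ v = v i + v j := by
    intro i j v; simp [e, add_dotProduct]
  have hsub : ∀ (i j : Fin n) (v : Fin n → ℝ), (e i - e j) ⬝ᵥ v = v i - v j := by
    intro i j v; simp [e, sub_dotProduct]
  have hsingle : ∀ (i : Fin n) (v : Fin n → ℝ), e i ⬝ᵥ v = v i := by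
    intro i v; simp [e]
  constructor
  · intro h
    refine ⟨fun i j hij => ?_, fun i hi => ?_⟩
    · rcases lt_or_gt_of_ne hij with hlt | hlt
      · have h1 := h _ (Or.inl ⟨i, j, hlt, Or.inl rfl⟩)
        have h2 := h _ (Or.inl ⟨i, j, hlt, Or.inr rfl⟩)
        rw [hadd, hadd] at h1
        rw [hsub, hsub] at h2
        exact ⟨h1, h2⟩
      · have h1 := h _ (Or.inl ⟨j, i, hlt, Or.inl rfl⟩)
        have h2 := h _ (Or.inl ⟨j, i, hlt, Or.inr rfl⟩)
        rw [hadd, hadd] at h1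
        rw [hsub, hsub] at h2
        rw [add_comm (y i), add_comm (x i), ← neg_sub (y j), ← neg_sub (x j)]
        exact ⟨h1, h2.neg⟩
    · have h1 := h _ (Or.inr ⟨i, hi, rfl⟩)
      rwa [hsingle, hsingle] at h1
  · rintro ⟨h1, h2⟩ α (⟨i, j, hij, rfl | rfl⟩ | ⟨i, hi, rfl⟩)
    · rw [hadd, hadd]; exact (h1 i j hij.ne).1
    · rw [hsub, hsub]; exact (h1 i j hij.ne).2
    · rw [hsingle, hsingle]; exact h2 i hi

lemma mem_cones_intermediate {c : Set (Fin n → ℝ)} :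
    c ∈ cones (intermediate n s) ↔ ∃ x, c = face (normals n s) x := by
  rw [intermediate_eq]
  -- the vector `(1, 2, …, n)` lies on none of the hyperplanes
  refine mem_cones_iff (z := fun i => (i : ℝ) + 1) (finite_normals n s) ?_
  rintro α (⟨i, j, hij, rfl | rfl⟩ | ⟨i, -, rfl⟩)
  · simp only [e, add_dotProduct, single_dotProduct, one_mul]
    positivity
  · simp only [e, sub_dotProduct, single_dotProduct, one_mul]
    have : (i : ℝ) < j := by exact_mod_cast hij
    exact fun h => this.ne (by linarith)
  · simp only [e, single_dotProduct, one_mul]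
    positivity

/-! ### Integer normal forms of faces -/

/-- The real vector with the given integer coordinates. -/
def realVec (f : Fin n → ℤ) : Fin n → ℝ := fun i => f i

lemma signLE_intCast {a b : ℤ} : SignLE (a : ℝ) (b : ℝ) ↔ SignLE a b := by
  simp [SignLE]

lemma faceLE_realVec {f g : Fin n → ℤ} : FaceLE s (realVec g) (realVec f) ↔ FaceLE s g f := by
  simp only [FaceLE, realVec]
  norm_cast
  simp only [signLE_intCast]

lemma abs_realVec (f : Fin n → ℤ) (i : Fin n) : |realVec f i| = ((|f i| : ℤ) : ℝ) := by
  simp [realVec]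

/-- The nonzero absolute values of the coordinates of `f` are exactly `1, …, k`. -/
def Packed (k : ℕ) (f : Fin n → ℤ) : Prop :=
  (∀ i, |f i| ≤ k) ∧ ∀ m : ℕ, 1 ≤ m → m ≤ k → ∃ i, |f i| = m

/-- A packed vector representing a `k`-dimensional face of `D_{n,s}`. If the arrangement does not
see the sign of the smallest coordinate, this coordinate is required to be `1`, which singles out
one of the packed vectors in the face. -/
def IsNormalForm (s k : ℕ) (f : Fin n → ℤ) : Prop :=
  Packed k f ∧ ∀ i, LoneMin s f i → f i = 1

lemma Packed.abs_le_abs {k : ℕ} {f g : Fin n → ℤ} (hf : Packed k f)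
    (hlt : ∀ i j, |f i| < |f j| → |g i| < |g j|) (hne : ∀ i, f i ≠ 0 → g i ≠ 0) (i : Fin n) :
    |f i| ≤ |g i| := by
  suffices h : ∀ (m : ℕ) (i : Fin n), |f i| = m → (m : ℤ) ≤ |g i| by
    have := h (f i).natAbs i (by simp)
    simpa using this
  intro m
  induction m with
  | zero => intro i _; simp
  | succ m ih =>
    intro i hi
    rcases Nat.eq_zero_or_pos m with rfl | hm
    · have : g i ≠ 0 := hne i fun h => by simp [h] at hi
      simpa using Int.one_le_abs this
    · have hle := hf.1 i
      obtain ⟨j, hj⟩ := hf.2 m hm (by omega)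
      have h1 := hlt j i (by omega)
      have h2 := ih j hj
      push_cast
      omega

/-- A face has only one normal form. -/
lemma IsNormalForm.eq_of_faceLE {k l : ℕ} {f g : Fin n → ℤ} (hf : IsNormalForm s k f)
    (hg : IsNormalForm s l g) (hfg : FaceLE s f g) (hgf : FaceLE s g f) : f = g := by
  rw [faceLE_iff] at hfg hgf
  have hle : ∀ i j, |f i| ≤ |f j| ↔ |g i| ≤ |g j| := by
    intro i j
    by_cases hij : i = j
    · subst hij; simp
    · exact ⟨hgf.1 i j hij, hfg.1 i j hij⟩
  have hlt : ∀ i j, |f i| < |f j| ↔ |g i| < |g j| := by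
    intro i j
    rw [← not_le, ← not_le, hle]
  have hlone := loneMin_congr (s := s) fun i j _ => hlt i j
  have hsign : ∀ i, (0 < f i ↔ 0 < g i) ∧ (f i < 0 ↔ g i < 0) := by
    intro i
    by_cases hi : LoneMin s f i
    · rw [hf.2 i hi, hg.2 i ((hlone i).1 hi)]; simp
    · have h1 := hgf.2 i hi
      have h2 := hfg.2 i (by rwa [← hlone])
      unfold SignLE at h1 h2
      omega
  ext i
  have h1 := hf.1.abs_le_abs (fun i j => (hlt i j).1) (fun i h => by have := hsign i; omega) i
  have h2 := hg.1.abs_le_abs (fun i j => (hlt i j).2) (fun i h => by have := hsign i; omega) i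
  have := hsign i
  simp only [Int.abs_eq_natAbs] at h1 h2
  omega

/-- The coordinates of a real vector can be replaced by integers without changing their signs and
the order of their absolute values. -/
lemma exists_packed (x : Fin n → ℝ) : ∃ (k : ℕ) (f : Fin n → ℤ), Packed k f ∧
    (∀ i j, |x i| ≤ |x j| ↔ |f i| ≤ |f j|) ∧
      ∀ i, SignLE (x i) (f i) ∧ SignLE ((f i : ℤ) : ℝ) (x i) := by
  classical
  let V : Finset ℝ := (Finset.univ.image fun i => |x i|).filter fun v => 0 < v
  -- `rk v` is the position of `v` among the positive absolute values
  let rk : ℝ → ℕ := fun v => (V.filter fun w => w ≤ v).card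
  have hmem : ∀ i, x i ≠ 0 → |x i| ∈ V := fun i hi => by
    simp only [V, Finset.mem_filter, Finset.mem_image, Finset.mem_univ, true_and]
    exact ⟨⟨i, rfl⟩, abs_pos.2 hi⟩
  have hmono : Monotone rk := fun v w h =>
    Finset.card_le_card (Finset.monotone_filter_right _ fun _ _ h' => h'.trans h)
  have hstrict : ∀ v, ∀ w ∈ V, v < w → rk v < rk w := by
    intro v w hw hvw
    refine Finset.card_lt_card (Finset.ssubset_iff_subset_ne.2
      ⟨Finset.monotone_filter_right _ fun _ _ h' => h'.trans hvw.le, fun h => ?_⟩)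
    have : w ∈ V.filter fun u => u ≤ v := by rw [h]; simp [hw]
    exact absurd (Finset.mem_filter.1 this).2 (not_le.2 hvw)
  have hrkpos : ∀ w ∈ V, 1 ≤ rk w := fun w hw =>
    Finset.card_pos.2 ⟨w, by simp [hw]⟩
  have hrk0 : rk 0 = 0 := by
    refine Finset.card_eq_zero.2 (Finset.filter_eq_empty_iff.2 fun w hw => ?_)
    exact not_le.2 (Finset.mem_filter.1 hw).2
  have himage : V.image rk = Finset.Icc 1 V.card := by
    apply Finset.eq_of_subset_of_card_le
    · intro m hm
      obtain ⟨w, hw, rfl⟩ := Finset.mem_image.1 hm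
      exact Finset.mem_Icc.2 ⟨hrkpos w hw, Finset.card_filter_le _ _⟩
    · rw [Finset.card_image_of_injOn, Nat.card_Icc, Nat.add_sub_cancel]
      intro v hv w hw h
      rcases lt_trichotomy v w with h' | h' | h'
      · exact absurd h (hstrict v w hw h').ne
      · exact h'
      · exact absurd h (hstrict w v hv h').ne'
  let f : Fin n → ℤ := fun i => if x i < 0 then -(rk |x i| : ℤ) else rk |x i|
  have habs : ∀ i, |f i| = rk |x i| := by
    intro i
    simp only [f]
    split_ifs <;> simp
  refine ⟨V.card, f, ⟨fun i => ?_, fun m h1 h2 => ?_⟩, fun i j => ?_, fun i => ?_⟩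
  · rw [habs]
    exact_mod_cast Finset.card_filter_le _ _
  · have : m ∈ V.image rk := by rw [himage]; exact Finset.mem_Icc.2 ⟨h1, h2⟩
    obtain ⟨w, hw, rfl⟩ := Finset.mem_image.1 this
    obtain ⟨i, -, hi⟩ := Finset.mem_image.1 (Finset.mem_filter.1 hw).1
    exact ⟨i, by rw [habs, ← hi]⟩
  · rw [habs, habs, Nat.cast_le]
    refine ⟨fun h => hmono h, fun h => not_lt.1 fun hlt => ?_⟩
    have := hstrict _ _ (hmem i (abs_pos.1 ((abs_nonneg _).trans_lt hlt))) hlt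
    omega
  · rcases lt_trichotomy (x i) 0 with h | h | h
    · have h1 := hrkpos _ (hmem i h.ne)
      have h2 : f i < 0 := by simp only [f, if_pos h]; omega
      have h3 : ((f i : ℤ) : ℝ) < 0 := by exact_mod_cast h2
      constructor <;> refine ⟨?_, ?_, ?_⟩ <;> intro h' <;> linarith
    · have h2 : f i = 0 := by simp [f, h, hrk0]
      rw [h2, h, Int.cast_zero]
      exact ⟨SignLE.zero _, SignLE.zero _⟩
    · have h1 := hrkpos _ (hmem i h.ne')
      have h2 : 0 < f i := by simp only [f, if_neg h.not_gt]; omega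
      have h3 : 0 < ((f i : ℤ) : ℝ) := by exact_mod_cast h2
      constructor <;> refine ⟨?_, ?_, ?_⟩ <;> intro h' <;> linarith

/-- A coordinate whose sign the arrangement does not see may be assumed to be positive. -/
lemma exists_equiv_pos_of_loneMin (s : ℕ) (x : Fin n → ℝ) :
    ∃ y : Fin n → ℝ, FaceLE s x y ∧ FaceLE s y x ∧ ∀ i, LoneMin s y i → 0 < y i := by
  by_cases h : ∃ i, LoneMin s x i
  · obtain ⟨i, hi⟩ := h
    obtain ⟨δ, h1, hδ⟩ : ∃ δ : ℝ, (∀ j, j ≠ i → δ < |x j|) ∧ 0 < δ := by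
      have h1 : ∀ᶠ δ in 𝓝[>] (0 : ℝ), ∀ j, j ≠ i → δ < |x j| := by
        rw [eventually_all]
        intro j
        by_cases hj : j = i
        · simp [hj]
        · filter_upwards [nhdsWithin_le_nhds
            (eventually_lt_nhds ((abs_nonneg _).trans_lt (hi.2 j hj)))] with δ hδ _ using hδ
      exact (h1.and self_mem_nhdsWithin).exists
    have hyi : Function.update x i δ i = δ := Function.update_self ..
    have hyj : ∀ j, j ≠ i → Function.update x i δ j = x j := fun j hj =>
      Function.update_of_ne hj ..
    generalize Function.update x i δ = y at hyi hyj
    have hord : ∀ j k, j ≠ k → (|x j| ≤ |x k| ↔ |y j| ≤ |y k|) := by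
      intro j k hjk
      by_cases hj : j = i
      · subst hj
        rw [hyi, hyj k hjk.symm, abs_of_pos hδ]
        exact iff_of_true (hi.2 k hjk.symm).le (h1 k hjk.symm).le
      · by_cases hk : k = i
        · subst hk
          rw [hyi, hyj j hj, abs_of_pos hδ]
          exact iff_of_false (not_le.2 (hi.2 j hj)) (not_le.2 (h1 j hj))
        · rw [hyj j hj, hyj k hk]
    have hlone := loneMin_congr (s := s) (x := x) (y := y) fun j k hjk => by
      rw [← not_le, ← not_le, hord k j hjk.symm]
    have huniq : ∀ j, LoneMin s x j → j = i := fun j hj => by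
      by_contra hne
      exact (hj.2 i (Ne.symm hne)).not_gt (hi.2 j hne)
    have hsame : ∀ j, ¬ LoneMin s x j → y j = x j := fun j hj =>
      hyj j fun h => hj (h ▸ hi)
    refine ⟨y, faceLE_iff.2 ⟨fun j k hjk => (hord j k hjk).2, fun j hj => ?_⟩,
      faceLE_iff.2 ⟨fun j k hjk => (hord j k hjk).1, fun j hj => ?_⟩, fun j hj => ?_⟩
    · rw [hsame j (by rwa [hlone])]; exact SignLE.refl _
    · rw [hsame j hj]; exact SignLE.refl _
    · rw [huniq j ((hlone j).2 hj), hyi]; exact hδ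
  · have hrefl : FaceLE s x x :=
      ⟨fun _ _ _ => ⟨SignLE.refl _, SignLE.refl _⟩, fun _ _ => SignLE.refl _⟩
    exact ⟨x, hrefl, hrefl, fun i hi => absurd ⟨i, hi⟩ h⟩

/-- Every face has a normal form. -/
lemma exists_isNormalForm (s : ℕ) (x : Fin n → ℝ) : ∃ (k : ℕ) (f : Fin n → ℤ),
    IsNormalForm s k f ∧ face (normals n s) x = face (normals n s) (realVec f) := by
  obtain ⟨y, hxy, hyx, hpos⟩ := exists_equiv_pos_of_loneMin s x
  obtain ⟨k, f, hf, hord, hsign⟩ := exists_packed y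
  have hord' : ∀ i j, |y i| ≤ |y j| ↔ |realVec f i| ≤ |realVec f j| := fun i j => by
    rw [abs_realVec, abs_realVec, Int.cast_le, hord]
  have hyf : FaceLE s y (realVec f) :=
    faceLE_iff.2 ⟨fun i j _ => (hord' i j).2, fun i _ => (hsign i).1⟩
  have hfy : FaceLE s (realVec f) y :=
    faceLE_iff.2 ⟨fun i j _ => (hord' i j).1, fun i _ => (hsign i).2⟩
  refine ⟨k, f, ⟨hf, fun i hi => ?_⟩, ?_⟩
  · have hlone := (loneMin_congr (s := s) (x := y) (y := f) (fun i j _ => by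
      rw [← not_le, ← not_le, hord]) i).2 hi
    have hpos : 0 < f i := by
      have h1 := hpos i hlone
      by_contra hneg
      rcases lt_or_eq_of_le (not_lt.1 hneg) with h | h
      · exact absurd ((hsign i).1.2.2 (by exact_mod_cast h)) (not_le.2 h1)
      · exact h1.ne' ((hsign i).1.1 (by exact_mod_cast h))
    have hle := hf.1 i
    rw [abs_of_pos hpos] at hle
    obtain ⟨j, hj⟩ := hf.2 1 le_rfl (by omega)
    by_contra hne
    have hji : j ≠ i := by rintro rfl; rw [abs_of_pos hpos] at hj; exact hne (by exact_mod_cast hj)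
    have := hi.2 j hji
    rw [abs_of_pos hpos, hj] at this
    norm_cast at this
    omega
  · apply Set.Subset.antisymm
    · exact face_subset_face_iff.2 (mem_face_normals.2 (hxy.trans hyf))
    · exact face_subset_face_iff.2 (mem_face_normals.2 (hfy.trans hyx))

/-! ### Rays of a face -/

section Rays

variable {n s k : ℕ}

open Classical in
/-- The generators of the rays of the face with normal form `f`, for `1 ≤ j ≤ k`. Usually this is
the sign vector of `f` restricted to the coordinates of absolute value at least `j`. If a lone
minimum makes the second of these vectors lie inside a two-dimensional face, that vector is replaced
by the reflection of the first one in the coordinate hyperplane of the lone minimum. -/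
noncomputable def rayGen (s : ℕ) (f : Fin n → ℤ) (j : ℕ) : Fin n → ℤ := fun i =>
  if LoneMin s f i ∧ j = 2 then -1 else if (j : ℤ) ≤ |f i| then (f i).sign else 0

lemma rayGen_of_not_loneMin {f : Fin n → ℤ} {i : Fin n} (hi : ¬ LoneMin s f i) (j : ℕ) :
    rayGen s f j i = if (j : ℤ) ≤ |f i| then (f i).sign else 0 := by
  simp [rayGen, hi]

lemma LoneMin.unique {f : Fin n → ℤ} {i j : Fin n} (hi : LoneMin s f i) (hj : LoneMin s f j) :
    i = j := by
  by_contra h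
  exact (hi.2 j (Ne.symm h)).not_gt (hj.2 i h)

lemma IsNormalForm.abs_loneMin {f : Fin n → ℤ} (hf : IsNormalForm s k f) {i : Fin n}
    (hi : LoneMin s f i) : |f i| = 1 := by
  rw [hf.2 i hi, abs_one]

lemma exists_ne_of_two_le (hn : 2 ≤ n) (i : Fin n) : ∃ j, j ≠ i := by
  have : Nontrivial (Fin n) := Fin.nontrivial_iff_two_le.2 hn
  exact exists_ne i

lemma IsNormalForm.two_le_of_loneMin (hn : 2 ≤ n) {f : Fin n → ℤ} (hf : IsNormalForm s k f)
    {i : Fin n} (hi : LoneMin s f i) : 2 ≤ k := by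
  obtain ⟨j, hj⟩ := exists_ne_of_two_le hn i
  have h1 := hi.2 j hj
  have h2 := hf.abs_loneMin hi
  have h3 := hf.1.1 j
  omega

lemma abs_sign_of_ne_zero {a : ℤ} (ha : a ≠ 0) : |a.sign| = 1 := by
  rcases lt_or_gt_of_ne ha with h | h
  · simp [Int.sign_eq_neg_one_of_neg h]
  · simp [Int.sign_eq_one_of_pos h]

lemma signLE_sign (a : ℤ) : SignLE a.sign a := by
  rcases lt_trichotomy a 0 with h | rfl | h
  · rw [Int.sign_eq_neg_one_of_neg h]; unfold SignLE; omega
  · exact SignLE.refl _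
  · rw [Int.sign_eq_one_of_pos h]; unfold SignLE; omega

lemma abs_rayGen {f : Fin n → ℤ} {j : ℕ} (hj : 1 ≤ j) (i : Fin n) :
    |rayGen s f j i| = 1 ∧ (LoneMin s f i ∧ j = 2 ∨ (j : ℤ) ≤ |f i|) ∨
      rayGen s f j i = 0 ∧ ¬ (LoneMin s f i ∧ j = 2) ∧ |f i| < j := by
  unfold rayGen
  split_ifs with h1 h2
  · simp [h1]
  · have : f i ≠ 0 := fun h => by rw [h, abs_zero] at h2; omega
    exact Or.inl ⟨abs_sign_of_ne_zero this, Or.inr h2⟩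
  · exact Or.inr ⟨rfl, h1, not_le.1 h2⟩

lemma packed_one_rayGen {f : Fin n → ℤ} (hf : IsNormalForm s k f) {j : ℕ} (hj : 1 ≤ j)
    (hjk : j ≤ k) : Packed 1 (rayGen s f j) := by
  refine ⟨fun i => ?_, fun m h1 h2 => ?_⟩
  · rcases abs_rayGen (s := s) (f := f) hj i with h | h
    · simp [h.1]
    · simp [h.1]
  · obtain rfl : m = 1 := by omega
    obtain ⟨i, hi⟩ := hf.1.2 j hj hjk
    refine ⟨i, ?_⟩
    rcases abs_rayGen (s := s) (f := f) hj i with h | h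
    · simp [h.1]
    · omega

lemma isNormalForm_rayGen (hn : 2 ≤ n) {f : Fin n → ℤ} (hf : IsNormalForm s k f) {j : ℕ}
    (hj : 1 ≤ j) (hjk : j ≤ k) : IsNormalForm s 1 (rayGen s f j) := by
  have hp := packed_one_rayGen hf hj hjk
  refine ⟨hp, fun i hi => ?_⟩
  exfalso
  have hothers : ∀ i', i' ≠ i → |rayGen s f j i'| = 1 ∧ |rayGen s f j i| = 0 := by
    intro i' hi'
    have h1 := hi.2 i' hi'
    have h2 := hp.1 i'
    have h3 := abs_nonneg (rayGen s f j i)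
    push_cast at h2
    omega
  obtain ⟨i₀, hi₀⟩ := exists_ne_of_two_le hn i
  have hzero := (hothers i₀ hi₀).2
  have hfi : ¬ (LoneMin s f i ∧ j = 2) ∧ |f i| < j := by
    rcases abs_rayGen (s := s) (f := f) hj i with h | h
    · omega
    · exact h.2
  have hlone : LoneMin s f i := by
    refine ⟨hi.1, fun i' hi' => ?_⟩
    rcases abs_rayGen (s := s) (f := f) hj i' with ⟨-, ⟨h1, h2⟩ | h⟩ | h
    · have h3 := h1.2 i (Ne.symm hi')
      have h4 := hf.abs_loneMin h1
      omega
    · exact hfi.2.trans_le h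
    · have := (hothers i' hi').1
      rw [h.1, abs_zero] at this
      omega
  have h1 := hf.abs_loneMin hlone
  have hj2 : j ≠ 2 := fun h => hfi.1 ⟨hlone, h⟩
  obtain ⟨i', hi'⟩ := hf.1.2 2 (by omega) (by omega)
  have hne : i' ≠ i := by rintro rfl; omega
  have h3 := (hothers i' hne).1
  rcases abs_rayGen (s := s) (f := f) hj i' with ⟨-, ⟨-, h⟩ | h⟩ | h
  · exact hj2 h
  · omega
  · rw [h.1, abs_zero] at h3
    omega

lemma rayGen_faceLE {f : Fin n → ℤ} (hf : IsNormalForm s k f) {j : ℕ} (hj : 1 ≤ j) :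
    FaceLE s (rayGen s f j) f := by
  refine faceLE_iff.2 ⟨fun i i' hne hle => ?_, fun i hi => ?_⟩
  · rcases abs_rayGen (s := s) (f := f) hj i with h | h
    · rcases abs_rayGen (s := s) (f := f) hj i' with h' | h'
      · rw [h.1, h'.1]
      · exfalso
        rcases h.2 with ⟨h1, h2⟩ | h1
        · have h3 := h1.2 i' hne.symm
          have h4 := hf.abs_loneMin h1
          omega
        · omega
    · rw [h.1, abs_zero]
      exact abs_nonneg _
  · rw [rayGen_of_not_loneMin hi]
    split_ifs
    · exact signLE_sign _
    · exact SignLE.zero _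

lemma rayGen_injOn {f : Fin n → ℤ} (hf : IsNormalForm s k f) :
    Set.InjOn (rayGen s f) (Set.Icc 1 k) := by
  have hne : ∀ j j', 1 ≤ j → j < j' → j' ≤ k → rayGen s f j ≠ rayGen s f j' := by
    intro j j' hj hlt hjk heq
    obtain ⟨i, hi⟩ := hf.1.2 j hj (by omega)
    have heq := congrFun heq i
    by_cases hl : LoneMin s f i
    · have h1 := hf.abs_loneMin hl
      have h2 := hf.2 i hl
      obtain rfl : j = 1 := by omega
      simp only [rayGen, h2] at heq
      split_ifs at heq <;> simp_all
      omega
    · rw [rayGen_of_not_loneMin hl, rayGen_of_not_loneMin hl, if_pos (by omega),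
        if_neg (by omega)] at heq
      have := Int.sign_eq_zero_iff_zero.1 heq
      rw [this, abs_zero] at hi
      omega
  intro j hj j' hj' heq
  rcases lt_trichotomy j j' with h | h | h
  · exact absurd heq (hne j j' hj.1 h hj'.2)
  · exact h
  · exact absurd heq.symm (hne j' j hj'.1 h hj.2)

lemma eq_sign_of_signLE {a b : ℤ} (h : SignLE a b) (ha : |a| = 1) : a = b.sign ∧ b ≠ 0 := by
  obtain ⟨h1, h2, h3⟩ := h
  rcases lt_trichotomy b 0 with hb | hb | hb
  · rw [Int.sign_eq_neg_one_of_neg hb]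
    have := h3 hb
    rw [abs_of_nonpos this] at ha
    omega
  · rw [h1 hb, abs_zero] at ha
    omega
  · rw [Int.sign_eq_one_of_pos hb]
    have := h2 hb
    rw [abs_of_nonneg this] at ha
    omega

/-- The vectors `rayGen s f j` exhaust the rays of the face with normal form `f`. -/
lemma exists_eq_rayGen (hn : 2 ≤ n) {f r : Fin n → ℤ} (hf : IsNormalForm s k f)
    (hr : IsNormalForm s 1 r) (hrf : FaceLE s r f) : ∃ j ∈ Set.Icc 1 k, rayGen s f j = r := by
  obtain ⟨hord, hsign⟩ := faceLE_iff.1 hrf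
  have hr1 : ∀ i, |r i| = 1 ∨ r i = 0 := by
    intro i
    have h1 := hr.1.1 i
    have h2 := abs_nonneg (r i)
    by_cases h : r i = 0
    · exact Or.inr h
    · have := Int.one_le_abs h
      push_cast at h1
      omega
  by_cases hlone : ∃ i, LoneMin s f i ∧ r i ≠ 0
  · -- all coordinates of `r` are nonzero, and the lone minimum has one of two signs
    obtain ⟨i, hi, hri⟩ := hlone
    have hone : |r i| = 1 := (hr1 i).resolve_right hri
    have hfi := hf.abs_loneMin hi
    have hother : ∀ i', i' ≠ i → r i' = (f i').sign := by
      intro i' hi'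
      have h1 := hord i i' hi'.symm (hi.2 i' hi').le
      have h2 : r i' ≠ 0 := fun h => by rw [h, abs_zero] at h1; omega
      exact (eq_sign_of_signLE (hsign i' fun h => hi' (h.unique hi))
        ((hr1 i').resolve_right h2)).1
    have hk := hf.two_le_of_loneMin hn hi
    rcases (abs_eq zero_le_one).1 hone with h | h
    · refine ⟨1, ⟨le_rfl, by omega⟩, funext fun i' => ?_⟩
      by_cases hi' : i' = i
      · subst hi'
        simp [rayGen, h, hf.2 i' hi]
      · have := hi.2 i' hi'
        rw [hother i' hi', rayGen_of_not_loneMin fun h => hi' (h.unique hi), if_pos (by omega)]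
    · refine ⟨2, ⟨by omega, hk⟩, funext fun i' => ?_⟩
      by_cases hi' : i' = i
      · subst hi'
        simp [rayGen, h, hi]
      · have := hi.2 i' hi'
        rw [hother i' hi', rayGen_of_not_loneMin fun h => hi' (h.unique hi), if_pos (by omega)]
  · push Not at hlone
    have hne : (Finset.univ.filter fun i => r i ≠ 0).Nonempty := by
      obtain ⟨i, hi⟩ := hr.1.2 1 le_rfl le_rfl
      exact ⟨i, by simp only [Finset.mem_filter_univ]; rintro h; simp [h] at hi⟩
    obtain ⟨i₁, hi₁, hmin⟩ := Finset.exists_min_image _ (fun i => |f i|) hne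
    simp only [Finset.mem_filter_univ] at hi₁ hmin
    have hnl : ∀ i, r i ≠ 0 → ¬ LoneMin s f i := fun i hi h => hi (hlone i h)
    have hr₁ := (hr1 i₁).resolve_right hi₁
    have hf₁ := (eq_sign_of_signLE (hsign i₁ (hnl i₁ hi₁)) hr₁).2
    have hlevel : ∀ i, |f i₁| ≤ |f i| → r i ≠ 0 := by
      intro i hle h
      by_cases h' : i₁ = i
      · subst h'; exact hi₁ h
      · have := hord i₁ i h' hle
        rw [h, abs_zero] at this
        omega
    have hcast : (((f i₁).natAbs : ℕ) : ℤ) = |f i₁| := (Int.abs_eq_natAbs _).symm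
    refine ⟨(f i₁).natAbs, ⟨Int.natAbs_pos.2 hf₁, ?_⟩, funext fun i => ?_⟩
    · have := hf.1.1 i₁
      omega
    · have hspecial : ¬ (LoneMin s f i ∧ (f i₁).natAbs = 2) := by
        rintro ⟨hi, h2⟩
        have hri := hlone i hi
        have : LoneMin s r i := by
          refine ⟨hi.1, fun i' hi' => ?_⟩
          have h1 := hi.2 i' hi'
          have h3 := hf.abs_loneMin hi
          rw [hri, abs_zero]
          exact abs_pos.2 (hlevel i' (by omega))
        have := hr.2 i this
        omega
      rw [rayGen, if_neg hspecial, hcast]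
      split_ifs with h
      · have hi := hlevel i h
        exact (eq_sign_of_signLE (hsign i (hnl i hi)) ((hr1 i).resolve_right hi)).1.symm
      · by_contra h'
        exact h (hmin i (Ne.symm h'))

/-- A face is determined by its rays. -/
lemma faceLE_of_rayGen_faceLE (hn : 2 ≤ n) {f g : Fin n → ℤ} (hf : IsNormalForm s k f)
    (h : ∀ j ∈ Set.Icc 1 k, FaceLE s (rayGen s f j) g) : FaceLE s f g := by
  have hlone : ∀ i, LoneMin s f i → LoneMin s g i := by
    intro i hi
    by_contra hg
    -- the first two rays have opposite signs in the coordinate of the lone minimum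
    have hk := hf.two_le_of_loneMin hn hi
    have h1 := (faceLE_iff.1 (h 1 ⟨le_rfl, by omega⟩)).2 i hg
    have h2 := (faceLE_iff.1 (h 2 ⟨by omega, hk⟩)).2 i hg
    have e1 : rayGen s f 1 i = 1 := by simp [rayGen, hf.2 i hi]
    have e2 : rayGen s f 2 i = -1 := by simp [rayGen, hi]
    rw [e1] at h1
    rw [e2] at h2
    unfold SignLE at h1 h2
    omega
  have hcast : ∀ i, (((f i).natAbs : ℕ) : ℤ) = |f i| := fun i => (Int.abs_eq_natAbs _).symm
  have hmem : ∀ i, f i ≠ 0 → (f i).natAbs ∈ Set.Icc 1 k := by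
    intro i hi
    have h1 := hf.1.1 i
    have h2 := hcast i
    exact ⟨Int.natAbs_pos.2 hi, by omega⟩
  refine faceLE_iff.2 ⟨fun i i' hne hle => ?_, fun i hi => ?_⟩
  · by_cases h0 : f i = 0
    · rw [h0, abs_zero]; exact abs_nonneg _
    have hi' : ¬ LoneMin s f i' := fun hl => ((hlone i' hl).2 i hne).not_ge hle
    have h1 := (faceLE_iff.1 (h _ (hmem i h0))).1 i i' hne hle
    have h2 := hcast i
    rcases abs_rayGen (s := s) (f := f) (hmem i h0).1 i with h3 | h3
    · rcases abs_rayGen (s := s) (f := f) (hmem i h0).1 i' with h4 | h4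
      · rcases h4.2 with h5 | h5
        · exact absurd h5.1 hi'
        · omega
      · rw [h3.1, h4.1, abs_zero] at h1
        omega
    · omega
  · by_cases h0 : f i = 0
    · rw [h0]; exact SignLE.zero _
    have hi' : ¬ LoneMin s f i := fun hl => hi (hlone i hl)
    have h1 := (faceLE_iff.1 (h _ (hmem i h0))).2 i hi
    rw [rayGen_of_not_loneMin hi', hcast, if_pos le_rfl] at h1
    unfold SignLE at h1 ⊢
    rcases lt_or_gt_of_ne h0 with h2 | h2
    · rw [Int.sign_eq_neg_one_of_neg h2] at h1; omega
    · rw [Int.sign_eq_one_of_pos h2] at h1; omega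

/-- Among the faces in normal form, the rays are those of level one. -/
lemma finrank_span_face_eq_one_iff (hn : 2 ≤ n) {f : Fin n → ℤ} (hf : IsNormalForm s k f) :
    Module.finrank ℝ (Submodule.span ℝ (face (normals n s) (realVec f))) = 1 ↔ k = 1 := by
  have hlone : ∀ {y : Fin n → ℝ}, FaceLE s y (realVec f) → (∀ i j, i ≠ j → |f i| ≤ |f j| →
      |y i| ≤ |y j|) ∧ ∀ j, ¬ LoneMin s f j → SignLE (y j) (f j) := by
    intro y hy
    obtain ⟨h1, h2⟩ := faceLE_iff.1 hy
    refine ⟨fun i j hij hle => h1 i j hij ?_, fun j hj => h2 j ?_⟩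
    · rw [abs_realVec, abs_realVec]; exact_mod_cast hle
    · rwa [loneMin_congr (y := f) fun i j _ => by rw [abs_realVec, abs_realVec, Int.cast_lt]]
  have hself : realVec f ∈ face (normals n s) (realVec f) := mem_face_self _
  constructor
  · intro h1
    by_contra hk
    rcases Nat.eq_zero_or_pos k with rfl | hpos
    · have hf0 : ∀ i, f i = 0 := fun i => abs_nonpos_iff.1 (by simpa using hf.1.1 i)
      have : face (normals n s) (realVec f) ⊆ {0} := by
        intro y hy
        rw [mem_face_normals] at hy
        refine funext fun i => ((hlone hy).2 i fun hl => ?_).1 (by simp [hf0])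
        have := hf.2 i hl
        rw [hf0] at this
        omega
      rw [Submodule.span_eq_bot.2 fun y hy => by simpa using this hy, finrank_bot] at h1
      omega
    · -- the point `f` and its truncation to the top level are linearly independent
      let t : Fin n → ℤ := fun i => if |f i| = k then f i else 0
      have ht : realVec t ∈ face (normals n s) (realVec f) := by
        rw [mem_face_normals, faceLE_realVec, faceLE_iff]
        refine ⟨fun i j _ hle => ?_, fun j _ => ?_⟩
        · have := hf.1.1 j
          by_cases hi : |f i| = k
          · have hj : |f j| = k := by omega
            simp only [t, if_pos hi, if_pos hj, hle]
          · simp only [t, if_neg hi, abs_zero, abs_nonneg]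
        · simp only [t]
          split_ifs
          · exact SignLE.refl _
          · exact SignLE.zero _
      obtain ⟨i, hi⟩ := hf.1.2 k hpos le_rfl
      obtain ⟨i', hi'⟩ := hf.1.2 1 le_rfl hpos
      have ht0 : (⟨_, Submodule.subset_span ht⟩ :
          Submodule.span ℝ (face (normals n s) (realVec f))) ≠ 0 := by
        intro h
        have h2 := congrFun (congrArg Subtype.val h) i
        simp only [realVec, t, if_pos hi, ZeroMemClass.coe_zero, Pi.zero_apply,
          Int.cast_eq_zero] at h2
        rw [h2, abs_zero] at hi
        omega
      obtain ⟨c, hc⟩ := exists_smul_eq_of_finrank_eq_one h1 ht0 ⟨_, Submodule.subset_span hself⟩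
      have h2 := congrFun (congrArg Subtype.val hc) i'
      have h3 : t i' = 0 := if_neg (by rw [hi']; exact_mod_cast Ne.symm hk)
      simp only [SetLike.mk_smul_mk, Pi.smul_apply, realVec, h3, Int.cast_zero, smul_zero] at h2
      have h4 : f i' = 0 := by exact_mod_cast h2.symm
      rw [h4, abs_zero] at hi'
      omega
  · rintro rfl
    obtain ⟨i₁, hi₁⟩ := hf.1.2 1 le_rfl le_rfl
    have hne : realVec f ≠ 0 := by
      intro h
      have : f i₁ = 0 := by simpa [realVec] using congrFun h i₁
      rw [this, abs_zero] at hi₁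
      omega
    have hnl : ∀ i, ¬ LoneMin s f i := fun i hi => by
      have := hf.two_le_of_loneMin hn hi
      omega
    have hspan : Submodule.span ℝ (face (normals n s) (realVec f)) = ℝ ∙ realVec f := by
      refine le_antisymm (Submodule.span_le.2 fun y hy => ?_)
        (Submodule.span_mono (Set.singleton_subset_iff.2 hself))
      rw [mem_face_normals] at hy
      obtain ⟨hord, hsign⟩ := hlone hy
      refine Submodule.mem_span_singleton.2 ⟨|y i₁|, funext fun i => ?_⟩
      obtain ⟨h1, h2, h3⟩ := hsign i (hnl i)
      rw [Pi.smul_apply, realVec, smul_eq_mul]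
      have hle := hf.1.1 i
      by_cases h0 : f i = 0
      · rw [h1 (by simp [h0]), h0, Int.cast_zero, mul_zero]
      have habs : |f i| = 1 := le_antisymm (by simpa using hle) (Int.one_le_abs h0)
      have hy : |y i₁| = |y i| := by
        by_cases hi : i = i₁
        · rw [hi]
        · exact le_antisymm (hord _ _ (Ne.symm hi) (by omega)) (hord _ _ hi (by omega))
      rw [hy]
      rcases (abs_eq zero_le_one).1 habs with h | h
      · rw [h, Int.cast_one, mul_one, abs_of_nonneg (h2 (by simp [h]))]
      · rw [h, Int.cast_neg, Int.cast_one, mul_neg, mul_one,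
          abs_of_nonpos (h3 (by simp [h])), neg_neg]
    rw [hspan, finrank_span_singleton hne]

/-- The closed face with normal form `f`. -/
noncomputable def faceOf (s : ℕ) (f : Fin n → ℤ) : Set (Fin n → ℝ) :=
  face (normals n s) (realVec f)

lemma faceOf_subset_iff {f g : Fin n → ℤ} : faceOf s f ⊆ faceOf s g ↔ FaceLE s f g := by
  rw [faceOf, faceOf, face_subset_face_iff, mem_face_normals, faceLE_realVec]

lemma mem_rays_intermediate (hn : 2 ≤ n) {r : Set (Fin n → ℝ)} :
    r ∈ rays (intermediate n s) ↔ ∃ f : Fin n → ℤ, IsNormalForm s 1 f ∧ r = faceOf s f := by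
  constructor
  · rintro ⟨hr, hrank⟩
    obtain ⟨x, rfl⟩ := mem_cones_intermediate.1 hr
    obtain ⟨k, f, hf, hx⟩ := exists_isNormalForm s x
    rw [hx] at hrank
    obtain rfl := (finrank_span_face_eq_one_iff hn hf).1 hrank
    exact ⟨f, hf, hx⟩
  · rintro ⟨f, hf, rfl⟩
    exact ⟨mem_cones_intermediate.2 ⟨_, rfl⟩, (finrank_span_face_eq_one_iff hn hf).2 rfl⟩

/-- The set of rays contained in the face with normal form `f`. -/
noncomputable def raysOf (s : ℕ) (f : Fin n → ℤ) : Set (Set (Fin n → ℝ)) :=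
  {r | r ∈ rays (intermediate n s) ∧ r ⊆ faceOf s f}

lemma raysOf_eq_image (hn : 2 ≤ n) {f : Fin n → ℤ} (hf : IsNormalForm s k f) :
    raysOf s f = (fun j => faceOf s (rayGen s f j)) '' Set.Icc 1 k := by
  ext r
  constructor
  · rintro ⟨hr, hsub⟩
    obtain ⟨g, hg, rfl⟩ := (mem_rays_intermediate hn).1 hr
    obtain ⟨j, hj, rfl⟩ := exists_eq_rayGen hn hf hg (faceOf_subset_iff.1 hsub)
    exact ⟨j, hj, rfl⟩
  · rintro ⟨j, hj, rfl⟩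
    exact ⟨(mem_rays_intermediate hn).2 ⟨_, isNormalForm_rayGen hn hf hj.1 hj.2, rfl⟩,
      faceOf_subset_iff.2 (rayGen_faceLE hf hj.1)⟩

/-- The arrangement `D_{n,s}` is simplicial: a `k`-dimensional face has exactly `k` rays. -/
lemma encard_raysOf (hn : 2 ≤ n) {f : Fin n → ℤ} (hf : IsNormalForm s k f) :
    (raysOf s f).encard = k := by
  rw [raysOf_eq_image hn hf, Set.InjOn.encard_image]
  · rw [← Finset.coe_Icc, Set.encard_coe_eq_coe_finsetCard, Nat.card_Icc, Nat.add_sub_cancel]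
  · intro j hj j' hj' heq
    refine rayGen_injOn hf hj hj' ?_
    exact (isNormalForm_rayGen hn hf hj.1 hj.2).eq_of_faceLE
      (isNormalForm_rayGen hn hf hj'.1 hj'.2)
      (faceOf_subset_iff.1 (le_of_eq heq)) (faceOf_subset_iff.1 (le_of_eq heq.symm))

lemma raysOf_injOn (hn : 2 ≤ n) {l : ℕ} {f g : Fin n → ℤ} (hf : IsNormalForm s k f)
    (hg : IsNormalForm s l g) (h : raysOf s f = raysOf s g) : f = g := by
  have key : ∀ {k : ℕ} {f g : Fin n → ℤ}, IsNormalForm s k f → raysOf s f = raysOf s g →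
      FaceLE s f g := by
    intro k f g hf h
    refine faceLE_of_rayGen_faceLE hn hf fun j hj => faceOf_subset_iff.1 ?_
    have : faceOf s (rayGen s f j) ∈ raysOf s f := by
      rw [raysOf_eq_image hn hf]
      exact ⟨j, hj, rfl⟩
    rw [h] at this
    exact this.2
  exact hf.eq_of_faceLE hg (key hf h) (key hg h.symm)

lemma complex_intermediate :
    complex (intermediate n s) = {σ | ∃ (k : ℕ) (f : Fin n → ℤ), IsNormalForm s k f ∧
      σ = raysOf s f} := by
  ext σ
  constructor
  · rintro ⟨c, hc, rfl⟩
    obtain ⟨x, rfl⟩ := mem_cones_intermediate.1 hc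
    obtain ⟨k, f, hf, hx⟩ := exists_isNormalForm s x
    exact ⟨k, f, hf, by rw [hx]; rfl⟩
  · rintro ⟨k, f, -, rfl⟩
    exact ⟨_, mem_cones_intermediate.2 ⟨realVec f, rfl⟩, rfl⟩

lemma setOf_mem_complex_encard (hn : 2 ≤ n) (k : ℕ) :
    {σ | σ ∈ complex (intermediate n s) ∧ σ.encard = k} =
      raysOf s '' {f : Fin n → ℤ | IsNormalForm s k f} := by
  ext σ
  constructor
  · rintro ⟨hσ, hcard⟩
    rw [complex_intermediate] at hσ
    obtain ⟨l, f, hf, rfl⟩ := hσ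
    rw [encard_raysOf hn hf] at hcard
    obtain rfl : l = k := by exact_mod_cast hcard
    exact ⟨f, hf, rfl⟩
  · rintro ⟨f, hf, rfl⟩
    refine ⟨?_, encard_raysOf hn hf⟩
    rw [complex_intermediate]
    exact ⟨k, f, hf, rfl⟩

lemma faceCount_intermediate (hn : 2 ≤ n) (k : ℕ) :
    faceCount (complex (intermediate n s)) k = {f : Fin n → ℤ | IsNormalForm s k f}.ncard := by
  rw [faceCount, setOf_mem_complex_encard hn, Set.InjOn.ncard_image]
  exact fun f hf g hg h => raysOf_injOn hn hf hg h

lemma Packed.le {f : Fin n → ℤ} (hf : Packed k f) : k ≤ n := by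
  have h : Finset.Icc 1 k ⊆ Finset.univ.image fun i => (f i).natAbs := by
    intro m hm
    rw [Finset.mem_Icc] at hm
    obtain ⟨i, hi⟩ := hf.2 m hm.1 hm.2
    rw [Int.abs_eq_natAbs] at hi
    exact Finset.mem_image.2 ⟨i, Finset.mem_univ _, by exact_mod_cast hi⟩
  have h1 := Finset.card_le_card h
  have h2 := Finset.card_image_le (s := Finset.univ) (f := fun i : Fin n => (f i).natAbs)
  simp only [Nat.card_Icc, Finset.card_univ, Fintype.card_fin] at h1 h2
  omega

lemma rankOf_intermediate (hn : 2 ≤ n) : rankOf (complex (intermediate n s)) = n := by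
  refine IsGreatest.csSup_eq ⟨?_, ?_⟩
  · have hf : IsNormalForm s n fun i : Fin n => ((i : ℤ) + 1) := by
      have habs : ∀ i : Fin n, |((i : ℕ) : ℤ) + 1| = ((i : ℕ) : ℤ) + 1 := fun i =>
        abs_of_nonneg (by positivity)
      refine ⟨⟨fun i => ?_, fun m h1 h2 => ⟨⟨m - 1, by omega⟩, ?_⟩⟩, fun i hi => ?_⟩
      · have := i.2
        rw [habs]
        omega
      · rw [habs, Nat.cast_sub h1]
        simp
      · by_contra h
        have h2 := hi.2 ⟨0, by omega⟩ fun h' => h (by rw [← h']; simp)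
        rw [habs, habs] at h2
        simp at h2
        omega
    refine ⟨raysOf s _, ?_, encard_raysOf hn hf⟩
    rw [complex_intermediate]
    exact ⟨n, _, hf, rfl⟩
  · rintro j ⟨σ, hσ, hj⟩
    rw [complex_intermediate] at hσ
    obtain ⟨k, f, hf, rfl⟩ := hσ
    rw [encard_raysOf hn hf] at hj
    have : k = j := by exact_mod_cast hj
    exact this ▸ hf.1.le

end Rays

/-! ### Counting normal forms -/

/-- The number of vectors in `ℤⁿ` whose nonzero coordinates have absolute values exactly in a given
set of `k` positive numbers; a coordinate is allowed to vanish if `z = 1` and not if `z = 0`.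
The recursion distinguishes whether the absolute value of the first coordinate occurs again. -/
def signedSurjCount (z : ℕ) : ℕ → ℕ → ℕ
  | 0, 0 => 1
  | 0, _ + 1 => 0
  | n + 1, k => (2 * k + z) * signedSurjCount z n k + 2 * k * signedSurjCount z n (k - 1)

/-- The integers with absolute value in `S`, and `0` if `z` holds. -/
def signedRange (z : Bool) (S : Finset ℕ) : Finset ℤ :=
  S.image (fun m : ℕ => (m : ℤ)) ∪ S.image (fun m : ℕ => -(m : ℤ)) ∪ if z then {0} else ∅

/-- The vectors with coordinates in `signedRange z S` whose absolute values take every value in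
`S`. -/
def signedSurj (z : Bool) (n : ℕ) (S : Finset ℕ) : Finset (Fin n → ℤ) :=
  (Fintype.piFinset fun _ => signedRange z S).filter fun f => ∀ m ∈ S, ∃ i, |f i| = m

lemma mem_signedRange {z : Bool} {S : Finset ℕ} {a : ℤ} :
    a ∈ signedRange z S ↔ a.natAbs ∈ S ∨ (z = true ∧ a = 0) := by
  simp only [signedRange, Finset.mem_union, Finset.mem_image]
  have h : ((∃ m ∈ S, (m : ℤ) = a) ∨ ∃ m ∈ S, -(m : ℤ) = a) ↔ a.natAbs ∈ S := by
    constructor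
    · rintro (⟨m, hm, rfl⟩ | ⟨m, hm, rfl⟩) <;> simpa using hm
    · intro h
      rcases Int.natAbs_eq a with h' | h'
      · exact Or.inl ⟨_, h, h'.symm⟩
      · exact Or.inr ⟨_, h, h'.symm⟩
  rw [h]
  cases z <;> simp

lemma mem_signedSurj {z : Bool} {n : ℕ} {S : Finset ℕ} {f : Fin n → ℤ} :
    f ∈ signedSurj z n S ↔ (∀ i, (f i).natAbs ∈ S ∨ (z = true ∧ f i = 0)) ∧
      ∀ m ∈ S, ∃ i, (f i).natAbs = m := by
  simp only [signedSurj, Finset.mem_filter, Fintype.mem_piFinset, mem_signedRange,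
    Int.abs_eq_natAbs, Nat.cast_inj]

/-- The vectors extending `a` to an element of `signedSurj z (n + 1) S` either attain all values in
`S` or all values but that of `a`. -/
lemma cons_mem_signedSurj {z : Bool} {n : ℕ} {S : Finset ℕ} {a : ℤ} {g : Fin n → ℤ}
    (ha : a.natAbs ∈ S) : (Fin.cons a g : Fin (n + 1) → ℤ) ∈ signedSurj z (n + 1) S ↔
      g ∈ signedSurj z n S ∪ signedSurj z n (S.erase a.natAbs) := by
  simp only [Finset.mem_union, mem_signedSurj, Fin.forall_fin_succ, Fin.exists_fin_succ,
    Fin.cons_zero, Fin.cons_succ, Finset.mem_erase]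
  constructor
  · rintro ⟨⟨-, h1⟩, h2⟩
    by_cases h : ∃ i, (g i).natAbs = a.natAbs
    · refine Or.inl ⟨h1, fun m hm => ?_⟩
      rcases h2 m hm with rfl | h'
      · exact h
      · exact h'
    · push Not at h
      refine Or.inr ⟨fun i => (h1 i).imp (fun h' => ⟨h i, h'⟩) id, fun m hm => ?_⟩
      exact (h2 m hm.2).resolve_left (Ne.symm hm.1)
  · rintro (⟨h1, h2⟩ | ⟨h1, h2⟩)
    · exact ⟨⟨Or.inl ha, h1⟩, fun m hm => Or.inr (h2 m hm)⟩
    · refine ⟨⟨Or.inl ha, fun i => (h1 i).imp (fun h => h.2) id⟩, fun m hm => ?_⟩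
      by_cases h : a.natAbs = m
      · exact Or.inl h
      · exact Or.inr (h2 m ⟨Ne.symm h, hm⟩)

lemma cons_zero_mem_signedSurj {n : ℕ} {S : Finset ℕ} {g : Fin n → ℤ} (hS : 0 ∉ S) :
    (Fin.cons 0 g : Fin (n + 1) → ℤ) ∈ signedSurj true (n + 1) S ↔ g ∈ signedSurj true n S := by
  simp only [mem_signedSurj, Fin.forall_fin_succ, Fin.exists_fin_succ, Fin.cons_zero, Fin.cons_succ]
  constructor
  · rintro ⟨⟨-, h1⟩, h2⟩
    exact ⟨h1, fun m hm => (h2 m hm).resolve_left (by rintro rfl; exact hS hm)⟩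
  · rintro ⟨h1, h2⟩
    exact ⟨⟨Or.inr ⟨trivial, trivial⟩, h1⟩, fun m hm => Or.inr (h2 m hm)⟩

lemma disjoint_signedSurj_erase {z : Bool} {n : ℕ} {S : Finset ℕ} {m : ℕ} (hm : m ∈ S)
    (hS : 0 ∉ S) : Disjoint (signedSurj z n S) (signedSurj z n (S.erase m)) := by
  rw [Finset.disjoint_left]
  intro f hf hf'
  rw [mem_signedSurj] at hf hf'
  obtain ⟨i, rfl⟩ := hf.2 m hm
  rcases hf'.1 i with h | ⟨-, h⟩
  · simp at h
  · exact hS (by simpa [h] using hm)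

lemma sum_signedRange {z : Bool} {S : Finset ℕ} (hS : 0 ∉ S) (φ : ℤ → ℕ) :
    ∑ a ∈ signedRange z S, φ a =
      ∑ m ∈ S, (φ m + φ (-m)) + if z then φ 0 else 0 := by
  have hpos : ∀ m ∈ S, 0 < m := fun m hm => Nat.pos_of_ne_zero fun h => hS (h ▸ hm)
  rw [signedRange, Finset.sum_union, Finset.sum_union, Finset.sum_image, Finset.sum_image,
    Finset.sum_add_distrib]
  · cases z <;> simp
  · intro a _ b _ h; simpa using h
  · intro a _ b _ h; simpa using h
  · rw [Finset.disjoint_left]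
    intro a ha hb
    obtain ⟨m, hm, rfl⟩ := Finset.mem_image.1 ha
    obtain ⟨l, hl, h⟩ := Finset.mem_image.1 hb
    have := hpos m hm
    omega
  · rw [Finset.disjoint_left]
    intro a ha hb
    have ha0 : a = 0 := by cases z <;> simp_all
    subst ha0
    simp at ha
    exact hS ha

lemma card_signedSurj (z : Bool) (n : ℕ) (S : Finset ℕ) (hS : 0 ∉ S) :
    (signedSurj z n S).card = signedSurjCount z.toNat n S.card := by
  induction n generalizing S with
  | zero =>
    rcases S.eq_empty_or_nonempty with rfl | hne
    · have : signedSurj z 0 ∅ = Finset.univ := by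
        ext f; simp [mem_signedSurj, eq_iff_true_of_subsingleton]
      rw [this]
      simp [signedSurjCount]
    · have : signedSurj z 0 S = ∅ := by
        obtain ⟨m, hm⟩ := hne
        ext f
        simp only [mem_signedSurj, IsEmpty.exists_iff, Finset.notMem_empty, iff_false]
        exact fun h => h.2 m hm
      obtain ⟨k, hk⟩ : ∃ k, S.card = k + 1 := ⟨S.card - 1, by have := hne.card_pos; omega⟩
      rw [this, hk, Finset.card_empty, signedSurjCount]
  | succ n ih =>
    have hfiber : (signedSurj z (n + 1) S).card = ∑ a ∈ signedRange z S,
        ((signedSurj z (n + 1) S).filter fun f => f 0 = a).card := by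
      refine Finset.card_eq_sum_card_fiberwise fun f hf => ?_
      exact mem_signedRange.2 ((mem_signedSurj.1 hf).1 0)
    have hcons : ∀ (a : ℤ) (T : Finset (Fin n → ℤ)),
        (∀ g : Fin n → ℤ, (Fin.cons a g : Fin (n + 1) → ℤ) ∈ signedSurj z (n + 1) S ↔ g ∈ T) →
        ((signedSurj z (n + 1) S).filter fun f => f 0 = a).card = T.card := by
      intro a T hT
      symm
      refine Finset.card_bij (fun g _ => (Fin.cons a g : Fin (n + 1) → ℤ)) (fun g hg => ?_)
        (fun g _ g' _ h => (Fin.cons_injective2 h).2) (fun f hf => ?_)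
      · simp [(hT g).2 hg]
      · rw [Finset.mem_filter] at hf
        have h : (Fin.cons a (Fin.tail f) : Fin (n + 1) → ℤ) = f := by
          rw [← hf.2, Fin.cons_self_tail]
        exact ⟨Fin.tail f, (hT _).1 (by rw [h]; exact hf.1), h⟩
    have hne : ∀ m ∈ S, ∀ a : ℤ, a.natAbs = m →
        ((signedSurj z (n + 1) S).filter fun f => f 0 = a).card =
          signedSurjCount z.toNat n S.card + signedSurjCount z.toNat n (S.card - 1) := by
      rintro m hm a rfl
      rw [hcons a _ fun g => cons_mem_signedSurj hm,
        Finset.card_union_of_disjoint (disjoint_signedSurj_erase hm hS), ih S hS,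
        ih _ fun h => hS (Finset.mem_of_mem_erase h), Finset.card_erase_of_mem hm]
    rw [hfiber, sum_signedRange hS, Finset.sum_congr rfl fun m hm => by
      rw [hne m hm m (by simp), hne m hm (-m) (by simp)], Finset.sum_const, smul_eq_mul,
      signedSurjCount]
    cases z
    · simp only [Bool.false_eq_true, if_false, Bool.toNat_false]
      ring
    · rw [if_pos rfl, hcons 0 _ fun g => cons_zero_mem_signedSurj hS, ih S hS]
      simp only [Bool.toNat_true]
      ring

section Count

variable {n s k : ℕ}

lemma packed_iff_mem_signedSurj {f : Fin n → ℤ} :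
    Packed k f ↔ f ∈ signedSurj true n (Finset.Icc 1 k) := by
  simp only [Packed, mem_signedSurj, Int.abs_eq_natAbs, Finset.mem_Icc, true_and, Nat.cast_inj,
    Nat.cast_le, and_imp]
  refine and_congr_left fun _ => forall_congr' fun i => ?_
  omega

lemma finite_isNormalForm : {f : Fin n → ℤ | IsNormalForm s k f}.Finite :=
  (signedSurj true n (Finset.Icc 1 k)).finite_toSet.subset fun _ hf =>
    packed_iff_mem_signedSurj.1 hf.1

lemma ncard_isNormalForm_self :
    {f : Fin n → ℤ | IsNormalForm n k f}.ncard = signedSurjCount 1 n k := by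
  have : {f : Fin n → ℤ | IsNormalForm n k f} = signedSurj true n (Finset.Icc 1 k) := by
    ext f
    rw [Finset.mem_coe, ← packed_iff_mem_signedSurj]
    exact ⟨fun h => h.1, fun h => ⟨h, fun i hi => absurd hi.1 (not_le.2 i.2)⟩⟩
  rw [this, Set.ncard_coe_finset, card_signedSurj _ _ _ (by simp), Nat.card_Icc,
    Nat.add_sub_cancel, Bool.toNat_true]

lemma IsNormalForm.succ {f : Fin n → ℤ} (hf : IsNormalForm s k f) : IsNormalForm (s + 1) k f :=
  ⟨hf.1, fun i hi => hf.2 i ⟨by have := hi.1; omega, hi.2⟩⟩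

/-- A packed vector that is a normal form for `D_{n,s+1}` but not for `D_{n,s}` has its strictly
smallest coordinate in position `s`, with value `0` or `-1`. -/
lemma isNormalForm_succ_diff (hs : s < n + 1) {f : Fin (n + 1) → ℤ} :
    IsNormalForm (s + 1) k f ∧ ¬ IsNormalForm s k f ↔
      Packed k f ∧ (∀ j, j ≠ ⟨s, hs⟩ → |f ⟨s, hs⟩| < |f j|) ∧ f ⟨s, hs⟩ ≠ 1 := by
  constructor
  · rintro ⟨h1, h2⟩
    have : ∃ i, LoneMin s f i ∧ f i ≠ 1 := by
      by_contra h
      push Not at h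
      exact h2 ⟨h1.1, h⟩
    obtain ⟨i, hi, hi1⟩ := this
    obtain rfl : i = ⟨s, hs⟩ := by
      by_contra h
      exact hi1 (h1.2 i ⟨Nat.lt_of_le_of_ne hi.1 fun h' => h (Fin.ext h'.symm), hi.2⟩)
    exact ⟨h1.1, hi.2, hi1⟩
  · rintro ⟨h1, h2, h3⟩
    refine ⟨⟨h1, fun i hi => ?_⟩, fun h => h3 (h.2 _ ⟨le_rfl, h2⟩)⟩
    exfalso
    have hne : i ≠ ⟨s, hs⟩ := fun h => by
      have h4 := hi.1
      rw [h] at h4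
      simp at h4
    exact (h2 i hne).not_gt (hi.2 _ hne.symm)

lemma insertNth_diff_iff {p : Fin (n + 1)} {a : ℤ} {g : Fin n → ℤ} :
    (Packed k (p.insertNth a g : Fin (n + 1) → ℤ) ∧
      (∀ j, j ≠ p → |(p.insertNth a g : Fin (n + 1) → ℤ) p| <
        |(p.insertNth a g : Fin (n + 1) → ℤ) j|) ∧
      (p.insertNth a g : Fin (n + 1) → ℤ) p ≠ 1) ↔
    a = 0 ∧ g ∈ signedSurj false n (Finset.Icc 1 k) ∨
      a = -1 ∧ 1 ≤ k ∧ g ∈ signedSurj false n (Finset.Icc 2 k) := by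
  simp only [Packed, Fin.forall_iff_succAbove p, Fin.exists_iff_succAbove p,
    Fin.insertNth_apply_same, Fin.insertNth_apply_succAbove, ne_eq, not_true_eq_false,
    false_imp_iff, true_and,
    Fin.succAbove_ne, not_false_eq_true, true_imp_iff, mem_signedSurj, Finset.mem_Icc,
    Bool.false_eq_true, false_and, or_false, Int.abs_eq_natAbs, Nat.cast_inj, Nat.cast_le,
    Nat.cast_lt, and_imp]
  constructor
  · rintro ⟨⟨⟨h1, h2⟩, h3⟩, h4, h5⟩
    have ha : a.natAbs ≤ 1 := by
      by_contra h
      rcases h3 1 le_rfl (by omega) with h' | ⟨i, hi⟩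
      · omega
      · have := h4 i
        omega
    have : a = 0 ∨ a = -1 := by omega
    rcases this with rfl | rfl
    · refine Or.inl ⟨rfl, fun i => ⟨h4 i, h2 i⟩, fun m hm hm' => (h3 m hm hm').resolve_left ?_⟩
      simp
      omega
    · refine Or.inr ⟨rfl, h1, fun i => ⟨h4 i, h2 i⟩, fun m hm hm' =>
        (h3 m (by omega) hm').resolve_left ?_⟩
      simp
      omega
  · rintro (⟨rfl, h1, h2⟩ | ⟨rfl, hk, h1, h2⟩)
    · exact ⟨⟨⟨by simp, fun i => (h1 i).2⟩, fun m hm hm' => Or.inr (h2 m hm hm')⟩,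
        fun i => (h1 i).1, by simp⟩
    · refine ⟨⟨⟨by simpa using hk, fun i => (h1 i).2⟩, fun m hm hm' => ?_⟩,
        fun i => (h1 i).1, by simp⟩
      rcases Nat.eq_or_lt_of_le hm with rfl | h
      · exact Or.inl (by simp)
      · exact Or.inr (h2 m h hm')

/-- Adding one coordinate hyperplane to `D_{n+1,s}` cuts a number of faces that does not depend
on `s`. -/
lemma ncard_isNormalForm_succ (hs : s < n + 1) :
    {f : Fin (n + 1) → ℤ | IsNormalForm (s + 1) k f}.ncard =
      {f : Fin (n + 1) → ℤ | IsNormalForm s k f}.ncard +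
        (signedSurjCount 0 n k + if 1 ≤ k then signedSurjCount 0 n (k - 1) else 0) := by
  have hsub : {f : Fin (n + 1) → ℤ | IsNormalForm s k f} ⊆ {f | IsNormalForm (s + 1) k f} :=
    fun f hf => hf.succ
  rw [← Set.ncard_sdiff_add_ncard_of_subset hsub finite_isNormalForm, add_comm]
  congr 1
  have hdiff : {f : Fin (n + 1) → ℤ | IsNormalForm (s + 1) k f} \ {f | IsNormalForm s k f} =
      (fun g : Fin n → ℤ => (Fin.insertNth ⟨s, hs⟩ 0 g : Fin (n + 1) → ℤ)) ''
          (signedSurj false n (Finset.Icc 1 k)) ∪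
        (fun g : Fin n → ℤ => (Fin.insertNth ⟨s, hs⟩ (-1) g : Fin (n + 1) → ℤ)) ''
          (if 1 ≤ k then signedSurj false n (Finset.Icc 2 k) else ∅ : Finset _) := by
    ext f
    obtain ⟨a, g, rfl⟩ : ∃ (a : ℤ) (g : Fin n → ℤ),
        (Fin.insertNth ⟨s, hs⟩ a g : Fin (n + 1) → ℤ) = f :=
      ⟨f ⟨s, hs⟩, _, Fin.insertNth_self_removeNth _ _⟩
    rw [Set.mem_sdiff, Set.mem_ofPred_eq, Set.mem_ofPred_eq, isNormalForm_succ_diff hs,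
      insertNth_diff_iff]
    simp only [Set.mem_union, Set.mem_image, Finset.mem_coe, Fin.insertNth_inj]
    refine or_congr ⟨fun h => ⟨g, h.2, h.1.symm, rfl⟩, ?_⟩ ⟨fun h => ⟨g, ?_, h.1.symm, rfl⟩, ?_⟩
    · rintro ⟨g, h, rfl, rfl⟩
      exact ⟨rfl, h⟩
    · rw [if_pos h.2.1]
      exact h.2.2
    · rintro ⟨g, h, rfl, rfl⟩
      split_ifs at h with hk
      · exact ⟨rfl, hk, h⟩
      · simp at h
  have hinj : ∀ a : ℤ, Function.Injective fun g : Fin n → ℤ =>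
      (Fin.insertNth ⟨s, hs⟩ a g : Fin (n + 1) → ℤ) := fun a g g' h =>
    (Fin.insertNth_inj.1 h).2
  rw [hdiff, Set.ncard_union_eq _ (Set.toFinite _) (Set.toFinite _),
    Set.ncard_image_of_injective _ (hinj _), Set.ncard_image_of_injective _ (hinj _),
    Set.ncard_coe_finset, Set.ncard_coe_finset, card_signedSurj _ _ _ (by simp), Nat.card_Icc]
  · congr 1
    split_ifs with hk
    · rw [card_signedSurj _ _ _ (by simp), Nat.card_Icc]
      simp [show k + 1 - 2 = k - 1 by omega]
    · rfl
  · rw [Set.disjoint_left]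
    rintro _ ⟨g, -, rfl⟩ ⟨g', -, h⟩
    have := (Fin.insertNth_inj.1 h).1
    omega

end Count

/-! ### Polynomials and γ-expansions -/

lemma signedSurjCount_eq_zero (z : ℕ) {n k : ℕ} (h : n < k) : signedSurjCount z n k = 0 := by
  induction n generalizing k with
  | zero =>
    obtain ⟨k, rfl⟩ : ∃ l, k = l + 1 := ⟨k - 1, by omega⟩
    rfl
  | succ n ih => rw [signedSurjCount, ih (by omega), ih (by omega), mul_zero, mul_zero, add_zero]

/-- The `h`-polynomial belonging to the face numbers `signedSurjCount z n`. -/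
noncomputable def surjPoly (z n : ℕ) : ℤ[X] :=
  ∑ k ∈ Finset.range (n + 1), C (signedSurjCount z n k : ℤ) * (X - 1) ^ (n - k)

/-- The operator `P ↦ ((2d + a) X + a) P + 2 X (1 - X) P'`. The recursions of the Eulerian
polynomials of types `A` and `B`, suitably normalized, are given by `a = 0` and `a = 1`. -/
noncomputable def eulerOp (a d : ℕ) : ℤ[X] →ₗ[ℤ] ℤ[X] :=
  LinearMap.mulLeft ℤ ((2 * (d : ℤ[X]) + (a : ℤ[X])) * X + (a : ℤ[X])) +
    LinearMap.mulLeft ℤ (2 * X * (1 - X)) ∘ₗ derivative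

lemma eulerOp_apply (a d : ℕ) (P : ℤ[X]) : eulerOp a d P =
    ((2 * (d : ℤ[X]) + (a : ℤ[X])) * X + (a : ℤ[X])) * P + 2 * X * (1 - X) * derivative P := rfl

lemma surjPoly_succ (z n : ℕ) : surjPoly z (n + 1) =
    ((2 * (n : ℤ[X]) + (z : ℤ[X])) * X + (2 - (z : ℤ[X]))) * surjPoly z n +
      2 * X * (1 - X) * derivative (surjPoly z n) := by
  have hl : surjPoly z (n + 1) = ∑ k ∈ Finset.range (n + 1), C (signedSurjCount z n k : ℤ) *
      ((2 * (k : ℤ[X]) + (z : ℤ[X])) * (X - 1) ^ (n + 1 - k) +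
        2 * ((k : ℤ[X]) + 1) * (X - 1) ^ (n - k)) := by
    have hterm : ∀ k : ℕ, C (signedSurjCount z (n + 1) k : ℤ) * (X - 1) ^ (n + 1 - k) =
        C (signedSurjCount z n k : ℤ) * ((2 * (k : ℤ[X]) + (z : ℤ[X])) * (X - 1) ^ (n + 1 - k)) +
          2 * (k : ℤ[X]) * (C (signedSurjCount z n (k - 1) : ℤ) * (X - 1) ^ (n + 1 - k)) := by
      intro k
      rw [signedSurjCount]
      push_cast
      simp only [map_add, map_mul, map_natCast, map_ofNat]
      ring
    rw [surjPoly, Finset.sum_congr rfl fun k _ => hterm k, Finset.sum_add_distrib,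
      Finset.sum_range_succ, signedSurjCount_eq_zero z (Nat.lt_succ_self n),
      Finset.sum_range_succ' (fun k => 2 * (k : ℤ[X]) * _)]
    simp only [Nat.cast_zero, map_zero, zero_mul, mul_zero, add_zero, Nat.add_sub_cancel,
      Nat.reduceSubDiff, Nat.cast_add, Nat.cast_one]
    rw [← Finset.sum_add_distrib]
    refine Finset.sum_congr rfl fun k _ => ?_
    ring
  rw [hl, surjPoly, derivative_sum, Finset.mul_sum, Finset.mul_sum, ← Finset.sum_add_distrib]
  refine Finset.sum_congr rfl fun k hk => ?_
  obtain ⟨m, rfl⟩ : ∃ m, n = k + m := ⟨n - k, by have := Finset.mem_range.1 hk; omega⟩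
  rw [show k + m + 1 - k = m + 1 by omega, Nat.add_sub_cancel_left, derivative_C_mul,
    derivative_pow, derivative_sub, derivative_X, derivative_one, sub_zero, mul_one]
  cases m with
  | zero => push_cast; simp; ring
  | succ m =>
    simp only [Nat.add_sub_cancel, map_natCast]
    push_cast
    ring

/-- The polynomials with an integral γ-expansion with respect to the degree `d`. -/
noncomputable def gammaSpan (d : ℕ) : Submodule ℤ ℤ[X] :=
  Submodule.span ℤ ((fun i => X ^ i * (1 + X) ^ (d - 2 * i)) ''
    (Finset.range (d / 2 + 1) : Set ℕ))

lemma mem_gammaSpan_iff {d : ℕ} {P : ℤ[X]} : P ∈ gammaSpan d ↔ ∃ γ : ℕ → ℤ,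
    P = ∑ i ∈ Finset.range (d / 2 + 1), C (γ i) * X ^ i * (1 + X) ^ (d - 2 * i) := by
  rw [gammaSpan, Submodule.mem_span_image_finset_iff_exists_fun']
  constructor
  · rintro ⟨γ, rfl⟩
    refine ⟨γ, Finset.sum_congr rfl fun i _ => ?_⟩
    rw [smul_eq_C_mul, mul_assoc]
  · rintro ⟨γ, rfl⟩
    refine ⟨γ, Finset.sum_congr rfl fun i _ => ?_⟩
    rw [smul_eq_C_mul, mul_assoc]

/-- The operator sends a γ-basis element of degree `d` to a combination of two of degree `d + 1`.
The second coefficient vanishes in the case where the exponent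
`d + 1 - 2 * (i + 1)` is a truncated difference. -/
lemma eulerOp_gammaBasis (a : ℕ) {d i : ℕ} (hi : 2 * i ≤ d) :
    eulerOp a d (X ^ i * (1 + X) ^ (d - 2 * i)) =
      (a + 2 * i) • (X ^ i * (1 + X) ^ (d + 1 - 2 * i)) +
        (4 * (d - 2 * i)) • (X ^ (i + 1) * (1 + X) ^ (d + 1 - 2 * (i + 1))) := by
  obtain ⟨m, rfl⟩ : ∃ m, d = 2 * i + m := ⟨d - 2 * i, by omega⟩
  have hX : (X : ℤ[X]) * derivative (X ^ i) = (i : ℤ[X]) * X ^ i := by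
    cases i with
    | zero => simp
    | succ i => simp only [derivative_X_pow, Nat.add_sub_cancel, map_natCast]; ring
  rw [eulerOp_apply, Nat.add_sub_cancel_left, show 2 * i + m + 1 - 2 * i = m + 1 by omega,
    show 2 * i + m + 1 - 2 * (i + 1) = m - 1 by omega, derivative_mul, derivative_pow (1 + X),
    derivative_add, derivative_one, derivative_X, zero_add, mul_one, nsmul_eq_mul, nsmul_eq_mul]
  have : 2 * X * (1 - X) * (derivative (X ^ i) * (1 + X) ^ m +
      X ^ i * (C (m : ℤ) * (1 + X) ^ (m - 1))) =
      2 * (1 - X) * (1 + X) ^ m * ((i : ℤ[X]) * X ^ i) +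
        2 * X * (1 - X) * (X ^ i * (C (m : ℤ) * (1 + X) ^ (m - 1))) := by
    rw [← hX]; ring
  rw [this]
  cases m with
  | zero => simp; ring
  | succ m =>
    simp only [Nat.add_sub_cancel, map_natCast]
    push_cast
    ring

lemma gammaBasis_mem {d i : ℕ} (hi : 2 * i ≤ d) : X ^ i * (1 + X) ^ (d - 2 * i) ∈ gammaSpan d :=
  Submodule.subset_span ⟨i, by simp; omega, rfl⟩

lemma eulerOp_mem_gammaSpan (a : ℕ) {d : ℕ} {P : ℤ[X]} (hP : P ∈ gammaSpan d) :
    eulerOp a d P ∈ gammaSpan (d + 1) := by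
  suffices h : gammaSpan d ≤ (gammaSpan (d + 1)).comap (eulerOp a d) from h hP
  rw [gammaSpan, Submodule.span_le]
  rintro _ ⟨i, hi, rfl⟩
  have hi : 2 * i ≤ d := by
    have := Finset.mem_range.1 (Finset.mem_coe.1 hi)
    omega
  rw [SetLike.mem_coe, Submodule.mem_comap, eulerOp_gammaBasis a hi]
  refine Submodule.add_mem _ (nsmul_mem (gammaBasis_mem (by omega)) _) ?_
  rcases hi.lt_or_eq with h | h
  · exact nsmul_mem (gammaBasis_mem (by omega)) _
  · simp [h]

lemma surjPoly_one_mem_gammaSpan (n : ℕ) : surjPoly 1 n ∈ gammaSpan n := by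
  induction n with
  | zero =>
    have : surjPoly 1 0 = X ^ 0 * (1 + X) ^ (0 - 2 * 0) := by
      simp [surjPoly, signedSurjCount]
    rw [this]
    exact gammaBasis_mem le_rfl
  | succ n ih =>
    have : surjPoly 1 (n + 1) = eulerOp 1 n (surjPoly 1 n) := by
      rw [surjPoly_succ, eulerOp_apply]
      push_cast
      ring
    rw [this]
    exact eulerOp_mem_gammaSpan 1 ih

/-- The polynomials `X * surjPoly 0 n` satisfy a recursion of the same type as the polynomials
`surjPoly 1 n`. -/
lemma X_mul_surjPoly_zero_succ (n : ℕ) : X * surjPoly 0 (n + 1) =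
    eulerOp 0 (n + 1) (X * surjPoly 0 n) := by
  rw [surjPoly_succ, eulerOp_apply, derivative_mul, derivative_X]
  push_cast
  ring

lemma X_mul_surjPoly_zero_mem_gammaSpan {n : ℕ} (hn : 1 ≤ n) :
    X * surjPoly 0 n ∈ gammaSpan (n + 1) := by
  induction n, hn using Nat.le_induction with
  | base =>
    have h : X * surjPoly 0 1 = 2 • (X ^ 1 * (1 + X) ^ (2 - 2 * 1)) := by
      simp [surjPoly, signedSurjCount, Finset.sum_range_succ]
      ring
    have hmem : X ^ 1 * (1 + X) ^ (2 - 2 * 1) ∈ gammaSpan 2 := gammaBasis_mem (by norm_num)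
    rw [h]
    exact nsmul_mem hmem 2
  | succ n _ ih =>
    rw [X_mul_surjPoly_zero_succ]
    exact eulerOp_mem_gammaSpan 0 ih

/-- The coefficients of a γ-expansion are unique. -/
lemma gamma_eq_zero_of_sum_eq_zero {d : ℕ} {γ : ℕ → ℤ}
    (h : ∑ i ∈ Finset.range (d / 2 + 1), C (γ i) * X ^ i * (1 + X) ^ (d - 2 * i) = 0)
    {k : ℕ} (hk : k ≤ d / 2) : γ k = 0 := by
  induction k using Nat.strong_induction_on with
  | _ k ih =>
    have h1 := congrArg (fun P : ℤ[X] => P.coeff k) h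
    simp only [finsetSum_coeff, coeff_zero] at h1
    rw [Finset.sum_eq_single_of_mem k (by simp; omega)] at h1
    · rw [mul_assoc, coeff_C_mul, coeff_X_pow_mul', if_pos le_rfl, Nat.sub_self,
        coeff_zero_eq_eval_zero] at h1
      simpa using h1
    · intro i _ hik
      rcases Nat.lt_or_gt_of_ne hik with hlt | hlt
      · rw [ih i hlt (by omega)]; simp
      · rw [mul_assoc, coeff_C_mul, coeff_X_pow_mul', if_neg (by omega), mul_zero]

lemma gamma_unique {d : ℕ} {γ γ' : ℕ → ℤ}
    (h : ∑ i ∈ Finset.range (d / 2 + 1), C (γ i) * X ^ i * (1 + X) ^ (d - 2 * i) =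
      ∑ i ∈ Finset.range (d / 2 + 1), C (γ' i) * X ^ i * (1 + X) ^ (d - 2 * i))
    {k : ℕ} (hk : k ≤ d / 2) : γ k = γ' k := by
  refine sub_eq_zero.1 (gamma_eq_zero_of_sum_eq_zero (d := d) (γ := fun i => γ i - γ' i) ?_ hk)
  rw [← sub_eq_zero, ← Finset.sum_sub_distrib] at h
  rw [← h]
  refine Finset.sum_congr rfl fun i _ => ?_
  rw [C_sub]
  ring

lemma existsUnique_isGammaVector {V : Type*} {Δ : Set (Set V)}
    (h : hPoly Δ ∈ gammaSpan (rankOf Δ)) : ∃! γ : ℕ → ℤ, IsGammaVector Δ γ := by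
  obtain ⟨γ, hγ⟩ := mem_gammaSpan_iff.1 h
  refine ⟨fun i => if i ≤ rankOf Δ / 2 then γ i else 0, ⟨fun i hi => if_neg (not_le.2 hi), ?_⟩,
    fun γ' hγ' => ?_⟩
  · rw [hγ]
    refine Finset.sum_congr rfl fun i hi => ?_
    have hi : i ≤ rankOf Δ / 2 := by have := Finset.mem_range.1 hi; omega
    simp only [if_pos hi]
  · funext i
    split_ifs with hi
    · exact gamma_unique (hγ'.2.symm.trans hγ) hi
    · exact hγ'.1 i (not_le.1 hi)

/-! ### The `h`-polynomials of the intermediate arrangements -/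

section HPoly

variable {n s : ℕ}

lemma hPoly_intermediate (hn : 2 ≤ n) : hPoly (complex (intermediate n s)) =
    ∑ k ∈ Finset.range (n + 1),
      C ({f : Fin n → ℤ | IsNormalForm s k f}.ncard : ℤ) * (X - 1) ^ (n - k) := by
  rw [hPoly, fPoly, rankOf_intermediate hn, ← Finset.sum_range_reflect, Polynomial.sum_comp]
  refine Finset.sum_congr rfl fun k hk => ?_
  have hk' : k ≤ n := by have := Finset.mem_range.1 hk; omega
  rw [faceCount_intermediate hn, show n + 1 - 1 - k = n - k by omega, show n - (n - k) = k by omega]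
  simp

lemma hPoly_intermediate_self (hn : 2 ≤ n) :
    hPoly (complex (intermediate n n)) = surjPoly 1 n := by
  rw [hPoly_intermediate hn, surjPoly]
  simp only [ncard_isNormalForm_self]

/-- The effect on the `h`-polynomial of adding one coordinate hyperplane. -/
lemma hPoly_intermediate_succ (hn : 1 ≤ n) (hs : s < n + 1) :
    hPoly (complex (intermediate (n + 1) (s + 1))) =
      hPoly (complex (intermediate (n + 1) s)) + X * surjPoly 0 n := by
  rw [hPoly_intermediate (by omega), hPoly_intermediate (by omega)]
  simp only [ncard_isNormalForm_succ hs]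
  push_cast
  simp only [C_add, add_mul, Finset.sum_add_distrib]
  congr 1
  have h1 : ∑ k ∈ Finset.range (n + 1 + 1),
      C (signedSurjCount 0 n k : ℤ) * (X - 1) ^ (n + 1 - k) = (X - 1) * surjPoly 0 n := by
    rw [Finset.sum_range_succ, signedSurjCount_eq_zero 0 (Nat.lt_succ_self n), surjPoly,
      Finset.mul_sum]
    simp only [Nat.cast_zero, C_0, zero_mul, add_zero]
    refine Finset.sum_congr rfl fun k hk => ?_
    rw [show n + 1 - k = n - k + 1 by have := Finset.mem_range.1 hk; omega, pow_succ]
    ring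
  have h2 : ∑ k ∈ Finset.range (n + 1 + 1),
      C (if 1 ≤ k then (signedSurjCount 0 n (k - 1) : ℤ) else 0) * (X - 1) ^ (n + 1 - k) =
        surjPoly 0 n := by
    rw [Finset.sum_range_succ', surjPoly]
    simp
  rw [h1, h2]
  ring

lemma hPoly_intermediate_mem_gammaSpan (hn : 2 ≤ n) (hs : s ≤ n) :
    hPoly (complex (intermediate n s)) ∈ gammaSpan n := by
  induction hs using Nat.decreasingInduction with
  | self =>
    rw [hPoly_intermediate_self hn]
    exact surjPoly_one_mem_gammaSpan n
  | of_succ s hs ih =>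
    obtain ⟨n, rfl⟩ : ∃ m, n = m + 1 := ⟨n - 1, by omega⟩
    rw [hPoly_intermediate_succ (by omega) hs] at ih
    exact (Submodule.add_mem_iff_left _ (X_mul_surjPoly_zero_mem_gammaSpan (by omega))).1 ih

end HPoly

/-! ### Maxima of permutations -/

section Maxima

variable {N : ℕ}

/-- The permutation whose one-line notation arises from that of `v` by inserting the new largest
letter after the first `p` letters. -/
def insertMax (p : Fin (N + 1)) (v : Equiv.Perm (Fin N)) : Equiv.Perm (Fin (N + 1)) :=
  (finSuccEquiv' p).trans ((Equiv.optionCongr v).trans (finSuccEquiv' (Fin.last N)).symm)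

lemma insertMax_self (p : Fin (N + 1)) (v : Equiv.Perm (Fin N)) :
    insertMax p v p = Fin.last N := by
  simp [insertMax]

lemma insertMax_succAbove (p : Fin (N + 1)) (v : Equiv.Perm (Fin N)) (i : Fin N) :
    insertMax p v (p.succAbove i) = (v i).castSucc := by
  simp [insertMax]

lemma insertMax_bijective : Function.Bijective
    fun q : Fin (N + 1) × Equiv.Perm (Fin N) => insertMax q.1 q.2 := by
  rw [Fintype.bijective_iff_injective_and_card]
  refine ⟨?_, by simp [Fintype.card_perm, Nat.factorial_succ]⟩
  rintro ⟨p, v⟩ ⟨q, w⟩ h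
  simp only at h
  obtain rfl : p = q := (insertMax p v).injective (by rw [insertMax_self, h, insertMax_self])
  refine Prod.ext rfl (Equiv.ext fun i => Fin.castSucc_injective _ ?_)
  simp only
  rw [← insertMax_succAbove p, ← insertMax_succAbove p, h]

lemma oneLine_le (v : Equiv.Perm (Fin N)) (j : ℕ) : oneLine v j ≤ N := by
  unfold oneLine
  split_ifs
  · exact (v _).2
  · exact Nat.zero_le _

lemma oneLine_insertMax (p : Fin (N + 1)) (v : Equiv.Perm (Fin N)) (j : ℕ) :
    oneLine (insertMax p v) j =
      if j ≤ p then oneLine v j else if j = p + 1 then N + 1 else oneLine v (j - 1) := by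
  have hp := p.2
  split_ifs with h1 h2
  · unfold oneLine
    by_cases hj : 1 ≤ j
    · rw [dif_pos ⟨hj, by omega⟩, dif_pos ⟨hj, by omega⟩]
      have : (⟨j - 1, by omega⟩ : Fin (N + 1)) = p.succAbove ⟨j - 1, by omega⟩ := by
        rw [Fin.succAbove_of_castSucc_lt _ _ (by rw [Fin.lt_def]; simp; omega)]
        rfl
      rw [this, insertMax_succAbove]
      rfl
    · rw [dif_neg (by omega), dif_neg (by omega)]
  · subst h2
    rw [oneLine, dif_pos ⟨by omega, by omega⟩]
    have : (⟨(p : ℕ) + 1 - 1, by omega⟩ : Fin (N + 1)) = p := Fin.ext (by simp)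
    rw [this, insertMax_self, Fin.val_last]
  · unfold oneLine
    by_cases hj : j ≤ N + 1
    · rw [dif_pos ⟨by omega, hj⟩, dif_pos ⟨by omega, by omega⟩]
      have : (⟨j - 1, by omega⟩ : Fin (N + 1)) = p.succAbove ⟨j - 1 - 1, by omega⟩ := by
        rw [Fin.succAbove_of_le_castSucc _ _ (by rw [Fin.le_def]; simp; omega)]
        ext
        simp
        omega
      rw [this, insertMax_succAbove]
      rfl
    · rw [dif_neg (by omega), dif_neg (by omega)]

/-- The positions of the maxima of `u`. -/
def maxima (u : Equiv.Perm (Fin N)) : Finset ℕ :=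
  (Finset.Icc 1 N).filter fun j => oneLine u (j - 1) < oneLine u j ∧ oneLine u (j + 1) < oneLine u j

lemma card_maxima (u : Equiv.Perm (Fin N)) : (maxima u).card = numMaxima u := rfl

lemma mem_maxima {u : Equiv.Perm (Fin N)} {j : ℕ} : j ∈ maxima u ↔ (1 ≤ j ∧ j ≤ N) ∧
    oneLine u (j - 1) < oneLine u j ∧ oneLine u (j + 1) < oneLine u j := by
  rw [maxima, Finset.mem_filter, Finset.mem_Icc]

lemma succ_notMem_maxima {u : Equiv.Perm (Fin N)} {j : ℕ} (hj : j ∈ maxima u) :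
    j + 1 ∉ maxima u := fun h => by
  have h1 := (mem_maxima.1 hj).2.2
  have h2 := (mem_maxima.1 h).2.1
  rw [Nat.add_sub_cancel] at h2
  omega

/-- The new largest letter is a maximum and destroys the maxima next to it. -/
lemma numMaxima_insertMax_eq_card (p : Fin (N + 1)) (v : Equiv.Perm (Fin N)) :
    numMaxima (insertMax p v) =
      ((maxima v).filter fun j => j ≠ (p : ℕ) ∧ j ≠ (p : ℕ) + 1).card + 1 := by
  have hp := p.2
  have hw := oneLine_le v
  have hmem : (p : ℕ) + 1 ∈ maxima (insertMax p v) := by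
    rw [mem_maxima, oneLine_insertMax, oneLine_insertMax, oneLine_insertMax]
    have h1 := hw p
    have h2 := hw (p + 1)
    refine ⟨⟨by omega, by omega⟩, ?_, ?_⟩
    · simp; omega
    · simp; omega
  rw [← card_maxima, ← Finset.card_erase_add_one hmem]
  congr 1
  refine Finset.card_bij' (fun (j : ℕ) _ => if j ≤ (p : ℕ) then j else j - 1)
    (fun (j : ℕ) _ => if j ≤ (p : ℕ) then j else j + 1) ?_ ?_ ?_ ?_
  · intro j hj
    rw [Finset.mem_erase, mem_maxima, oneLine_insertMax, oneLine_insertMax, oneLine_insertMax] at hj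
    obtain ⟨hjp, ⟨h1, h2⟩, h3, h4⟩ := hj
    rw [Finset.mem_filter, mem_maxima]
    rcases lt_trichotomy j p with h | h | h
    · rw [if_pos (by omega), if_pos (by omega)] at h3 h4
      rw [if_pos h.le]
      exact ⟨⟨⟨h1, by omega⟩, h3, h4⟩, by omega, by omega⟩
    · have := hw j
      rw [if_neg (by omega), if_pos (by omega), if_pos (by omega)] at h4
      omega
    · have h5 : j ≠ p + 2 := by
        rintro rfl
        have := hw (p + 2 - 1)
        rw [if_neg (by omega), if_pos (by omega), if_neg (by omega), if_neg (by omega)] at h3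
        omega
      rw [if_neg (by omega), if_neg (by omega), if_neg (by omega), if_neg (by omega)] at h3 h4
      rw [if_neg (by omega), Nat.sub_add_cancel h1]
      exact ⟨⟨⟨by omega, by omega⟩, h3, h4⟩, by omega, by omega⟩
  · intro j hj
    rw [Finset.mem_filter, mem_maxima] at hj
    obtain ⟨⟨⟨h1, h2⟩, h3, h4⟩, h5, h6⟩ := hj
    rw [Finset.mem_erase, mem_maxima, oneLine_insertMax, oneLine_insertMax, oneLine_insertMax]
    by_cases h : j ≤ p
    · simp only [if_pos h]
      rw [if_pos (by omega), if_pos (by omega)]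
      exact ⟨by omega, ⟨h1, by omega⟩, h3, h4⟩
    · simp only [if_neg h]
      rw [if_neg (by omega), if_neg (by omega), if_neg (by omega), if_neg (by omega),
        if_neg (by omega), if_neg (by omega)]
      exact ⟨by omega, ⟨by omega, by omega⟩, h3, h4⟩
  · intro j hj
    have := (Finset.mem_erase.1 hj).1
    by_cases h : j ≤ p
    · simp [h]
    · simp only [if_neg h]
      rw [if_neg (by omega)]
      omega
  · intro j hj
    have := (Finset.mem_filter.1 hj).2
    by_cases h : j ≤ p
    · simp [h]
    · simp only [if_neg h]
      rw [if_neg (by omega)]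
      omega

/-- The positions at which inserting the largest letter does not change the number of maxima. -/
def adjacentToMaxima (v : Equiv.Perm (Fin N)) : Finset ℕ :=
  maxima v ∪ (maxima v).image fun j => j - 1

lemma mem_adjacentToMaxima {v : Equiv.Perm (Fin N)} {p : ℕ} :
    p ∈ adjacentToMaxima v ↔ p ∈ maxima v ∨ p + 1 ∈ maxima v := by
  rw [adjacentToMaxima, Finset.mem_union, Finset.mem_image]
  refine or_congr_right ⟨?_, fun h => ⟨p + 1, h, rfl⟩⟩
  rintro ⟨j, hj, rfl⟩
  rwa [Nat.sub_add_cancel (mem_maxima.1 hj).1.1]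

lemma card_adjacentToMaxima (v : Equiv.Perm (Fin N)) :
    (adjacentToMaxima v).card = 2 * numMaxima v := by
  rw [adjacentToMaxima, Finset.card_union_of_disjoint, Finset.card_image_of_injOn, card_maxima,
    two_mul]
  · intro i hi j hj h
    have h1 := (mem_maxima.1 hi).1.1
    have h2 := (mem_maxima.1 hj).1.1
    simp only at h
    omega
  · rw [Finset.disjoint_left]
    intro p hp hp'
    obtain ⟨j, hj, rfl⟩ := Finset.mem_image.1 hp'
    have := succ_notMem_maxima hp
    rw [Nat.sub_add_cancel (mem_maxima.1 hj).1.1] at this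
    exact this hj

lemma adjacentToMaxima_subset (v : Equiv.Perm (Fin N)) :
    adjacentToMaxima v ⊆ Finset.range (N + 1) := by
  intro p hp
  rw [Finset.mem_range]
  rcases mem_adjacentToMaxima.1 hp with h | h
  · have := (mem_maxima.1 h).1; omega
  · have := (mem_maxima.1 h).1; omega

lemma two_mul_numMaxima_le (v : Equiv.Perm (Fin N)) : 2 * numMaxima v ≤ N + 1 := by
  rw [← card_adjacentToMaxima, ← Finset.card_range (N + 1)]
  exact Finset.card_le_card (adjacentToMaxima_subset v)

lemma numMaxima_insertMax (p : Fin (N + 1)) (v : Equiv.Perm (Fin N)) :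
    numMaxima (insertMax p v) =
      if (p : ℕ) ∈ adjacentToMaxima v then numMaxima v else numMaxima v + 1 := by
  rw [numMaxima_insertMax_eq_card]
  have hfilter : ((maxima v).filter fun j => j ≠ (p : ℕ) ∧ j ≠ (p : ℕ) + 1) =
      ((maxima v).erase p).erase (p + 1) := by
    ext j
    simp only [Finset.mem_filter, Finset.mem_erase]
    tauto
  rw [hfilter]
  by_cases h1 : (p : ℕ) ∈ maxima v
  · rw [if_pos (mem_adjacentToMaxima.2 (Or.inl h1)),
      Finset.erase_eq_of_notMem fun h => succ_notMem_maxima h1 (Finset.mem_of_mem_erase h),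
      Finset.card_erase_add_one h1, card_maxima]
  · rw [Finset.erase_eq_of_notMem h1]
    by_cases h2 : (p : ℕ) + 1 ∈ maxima v
    · rw [if_pos (mem_adjacentToMaxima.2 (Or.inr h2)), Finset.card_erase_add_one h2, card_maxima]
    · rw [if_neg fun h => (mem_adjacentToMaxima.1 h).elim h1 h2, Finset.erase_eq_of_notMem h2,
        card_maxima]

/-- Inserting the largest letter in all possible ways. -/
lemma sum_numMaxima_succ {M : Type*} [AddCommMonoid M] (φ : ℕ → M) :
    ∑ u : Equiv.Perm (Fin (N + 1)), φ (numMaxima u) =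
      ∑ v : Equiv.Perm (Fin N), ((2 * numMaxima v) • φ (numMaxima v) +
        (N + 1 - 2 * numMaxima v) • φ (numMaxima v + 1)) := by
  rw [← insertMax_bijective.sum_comp, Fintype.sum_prod_type_right]
  refine Finset.sum_congr rfl fun v _ => ?_
  simp only [numMaxima_insertMax]
  rw [Fin.sum_univ_eq_sum_range (fun p => φ (if p ∈ adjacentToMaxima v then numMaxima v
    else numMaxima v + 1)), ← Finset.sum_sdiff (adjacentToMaxima_subset v), add_comm]
  congr 1
  · rw [Finset.sum_congr rfl fun p hp => by rw [if_pos hp], Finset.sum_const, card_adjacentToMaxima]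
  · rw [Finset.sum_congr rfl fun p hp => by rw [if_neg (Finset.mem_sdiff.1 hp).2],
      Finset.sum_const, Finset.card_sdiff_of_subset (adjacentToMaxima_subset v),
      card_adjacentToMaxima, Finset.card_range]

/-- The expansion of an Eulerian polynomial in terms of the numbers of maxima of permutations. -/
lemma two_mul_X_mul_surjPoly_zero (hN : 1 ≤ N) : 2 * (X * surjPoly 0 N) =
    ∑ u : Equiv.Perm (Fin N),
      (4 * X : ℤ[X]) ^ numMaxima u * (1 + X) ^ (N + 1 - 2 * numMaxima u) := by
  induction N, hN using Nat.le_induction with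
  | base =>
    have h1 : ∀ u : Equiv.Perm (Fin 1), numMaxima u = 1 := by decide
    simp [h1, surjPoly, signedSurjCount, Finset.sum_range_succ]
    ring
  | succ N _ ih =>
    rw [sum_numMaxima_succ (fun m => (4 * X : ℤ[X]) ^ m * (1 + X) ^ (N + 1 + 1 - 2 * m)),
      X_mul_surjPoly_zero_succ]
    have hsmul : ∀ (m : ℕ) (P : ℤ[X]), (4 * X) ^ m * P = (4 : ℤ) ^ m • (X ^ m * P) := by
      intro m P
      rw [mul_pow, zsmul_eq_mul]
      push_cast
      ring
    rw [two_mul, ← map_add, ← two_mul, ih, map_sum]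
    refine Finset.sum_congr rfl fun v _ => ?_
    rw [hsmul, map_smul, eulerOp_gammaBasis 0 (two_mul_numMaxima_le v)]
    simp only [nsmul_eq_mul, zsmul_eq_mul, mul_pow]
    push_cast
    ring

lemma sum_numMaxima_eq_sum_card (N : ℕ) : ∑ u : Equiv.Perm (Fin N),
    (4 * X : ℤ[X]) ^ numMaxima u * (1 + X) ^ (N + 1 - 2 * numMaxima u) =
      ∑ k ∈ Finset.range ((N + 1) / 2 + 1),
        C (4 ^ k * ((Finset.univ.filter fun u : Equiv.Perm (Fin N) => numMaxima u = k).card : ℤ)) *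
          X ^ k * (1 + X) ^ (N + 1 - 2 * k) := by
  rw [← Finset.sum_fiberwise_of_maps_to (s := Finset.univ) (t := Finset.range ((N + 1) / 2 + 1))
    (g := numMaxima) fun u _ => by
      have := two_mul_numMaxima_le u
      rw [Finset.mem_range]
      omega]
  refine Finset.sum_congr rfl fun k _ => ?_
  rw [Finset.sum_congr rfl fun u hu => by rw [(Finset.mem_filter.1 hu).2], Finset.sum_const,
    nsmul_eq_mul]
  simp only [C_mul, C_pow, map_natCast, map_ofNat]
  rw [mul_pow]
  ring

end Maxima

end SimplicialArrangement

open SimplicialArrangement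
theorem mainTheorem4 (n : ℕ) (hn : 2 ≤ n) :
    ((hPoly (complex (typeB n))).map (Int.castRingHom ℚ) -
        (hPoly (complex (intermediate n (n - 1)))).map (Int.castRingHom ℚ) =
      C (1 / 2 : ℚ) * ∑ u : Equiv.Perm (Fin (n - 1)),
        (4 * X) ^ numMaxima u * (1 + X) ^ (n - 2 * numMaxima u)) ∧
    (∀ s : ℕ, s ≤ n → ∃! γ : ℕ → ℤ, IsGammaVector (complex (intermediate n s)) γ) ∧
    (∀ i : ℕ, 1 ≤ i → i ≤ n → ∀ γ γ' : ℕ → ℤ,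
      IsGammaVector (complex (intermediate n i)) γ →
      IsGammaVector (complex (intermediate n (i - 1))) γ' →
      ∀ k : ℕ, k ≤ n / 2 →
        (γ k : ℚ) - (γ' k : ℚ) =
          1 / 2 * 4 ^ k *
            (Finset.univ.filter fun u : Equiv.Perm (Fin (n - 1)) => numMaxima u = k).card) := by
  generalize hnN : n - 1 = N
  obtain rfl : n = N + 1 := by omega
  have hN : 1 ≤ N := by omega
  refine ⟨?_, fun s hs => ?_, fun i hi hiN γ γ' hγ hγ' k hk => ?_⟩
  · have h := congrArg (Polynomial.map (Int.castRingHom ℚ)) (two_mul_X_mul_surjPoly_zero hN)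
    simp only [Polynomial.map_mul, Polynomial.map_sum, Polynomial.map_pow, Polynomial.map_add,
      Polynomial.map_one, map_X, Polynomial.map_ofNat] at h
    rw [typeB_eq_intermediate, hPoly_intermediate_succ hN (Nat.lt_succ_self N), Polynomial.map_add,
      add_sub_cancel_left, ← h, Polynomial.map_mul, map_X, ← mul_assoc,
      show (2 : ℚ[X]) = C 2 from rfl, ← C_mul]
    norm_num
  · apply existsUnique_isGammaVector
    rw [rankOf_intermediate hn]
    exact hPoly_intermediate_mem_gammaSpan hn hs
  · obtain ⟨s, rfl⟩ : ∃ s, i = s + 1 := ⟨i - 1, by omega⟩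
    rw [Nat.add_sub_cancel] at hγ'
    have h1 := hγ.2
    have h2 := hγ'.2
    rw [rankOf_intermediate hn] at h1 h2
    have h3 := two_mul_X_mul_surjPoly_zero hN
    rw [sum_numMaxima_eq_sum_card, ← add_sub_cancel_left (hPoly (complex (intermediate (N + 1) s)))
      (X * surjPoly 0 N), ← hPoly_intermediate_succ hN (by omega), h1, h2,
      ← Finset.sum_sub_distrib, Finset.mul_sum] at h3
    have h4 := gamma_unique (γ := fun j => 2 * (γ j - γ' j)) (k := k)
      (Eq.trans (Finset.sum_congr rfl fun j _ => by
        simp only [C_mul, C_sub, map_ofNat]; ring) h3) hk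
    have h5 : (2 : ℚ) * (γ k - γ' k) = 4 ^ k *
        (Finset.univ.filter fun u : Equiv.Perm (Fin N) => numMaxima u = k).card := by
      exact_mod_cast h4
    linarith
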